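/- For a quadratic field $K$ let $\Delta_K$ be its discriminant, and say that $\mathbb Z/11\mathbb Z$ appears as a torsion group over $K$ if there is an elliptic curve $E$ over $K$ with $E(K)_{\mathrm{tors}}\cong\mathbb Z/11\mathbb Z$. Let $X_1(11)$ be the elliptic curve $y^2-y=x^3-x^2$, where a point $(x,y)$ with $x\ne 0$ parametrizes the curve $$E_{x,y}:\ Y^2+(1-c)XY-bY=X^3-bX^2,\qquad c=\frac{y(y-x)}{x},\quad b=(1-y)c,$$ with the marked point $(0,0)$ (of order $11$ when $E_{x,y}$ is nonsingular); the cusps are the point at infinity, the points with $x=0$, and the points for which $E_{x,y}$ is singular. (1) The quadratic field of smallest $|\Delta_K|$ over which $\mathbb Z/11\mathbb Z$ appears as a torsion group is $\mathbb Q(\sqrt{-7})$: the group appears over $\mathbb Q(\sqrt{-7})$, and if it appears over a quadratic field $K$, then $|\Delta_K|\ge|\Delta_{\mathbb Q(\sqrt{-7})}|$, with equality only if $K\cong\mathbb Q(\sqrt{-7})$. (2) For $K=\mathbb Q(i),\ \mathbb Q(\sqrt{-3}),\ \mathbb Q(\sqrt5)$ the group $X_1(11)(K)$ has rank $0$, and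 its torsion subgroup is isomorphic to $\mathbb Z/5\mathbb Z$ and consists of cusps. (3) There is a noncuspidal point $(x,y)\in X_1(11)(\mathbb Q(\sqrt{-7}))$ of infinite order such that $E_{x,y}$ is isomorphic over $\mathbb Q(\sqrt{-7})$, by an isomorphism that maps $(0,0)$ to $(0,0)$, to the elliptic curve $$Y^2+\frac{85+33\sqrt{-7}}{128}XY+\frac{85\sqrt{-7}-999}{16384}Y=X^3+\frac{89\sqrt{-7}-275}{4096}X^2,$$ on which $(0,0)$ is a point of order $11$. -/

import Mathlib

/-- The quadratic algebra `ℚ(√d)`, with elements `a + b √d` written `⟨a, b⟩`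
(a field as soon as `d` is not a square in `ℚ`). -/
abbrev QuadField (d : ℚ) : Type := QuadraticAlgebra ℚ d 0

/-- The square root `√d` in `ℚ(√d)`. -/
def QuadField.sqrtGen (d : ℚ) : QuadField d := ⟨0, 1⟩

instance QuadField.fact_neg_one : Fact (∀ r : ℚ, r ^ 2 ≠ (-1) + 0 * r) :=
  ⟨fun r h => by nlinarith [sq_nonneg r]⟩

instance QuadField.fact_neg_three : Fact (∀ r : ℚ, r ^ 2 ≠ (-3) + 0 * r) :=
  ⟨fun r h => by nlinarith [sq_nonneg r]⟩

instance QuadField.fact_neg_seven : Fact (∀ r : ℚ, r ^ 2 ≠ (-7) + 0 * r) :=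
  ⟨fun r h => by nlinarith [sq_nonneg r]⟩

instance QuadField.fact_five : Fact (∀ r : ℚ, r ^ 2 ≠ 5 + 0 * r) :=
  ⟨fun r h => by
    have h5 : Irrational (Real.sqrt 5) := by
      simpa using Nat.Prime.irrational_sqrt (p := 5) (by norm_num)
    have hr : ((r : ℝ)) ^ 2 = 5 := by
      have h1 : r ^ 2 = 5 := by linarith
      exact_mod_cast h1
    apply h5
    refine ⟨|r|, ?_⟩
    rw [← hr, Real.sqrt_sq_eq_abs]
    push_cast
    rfl⟩

instance QuadField.instNumberField (d : ℚ) [Fact (∀ r : ℚ, r ^ 2 ≠ d + 0 * r)] :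
    NumberField (QuadField d) where
  to_charZero := inferInstance
  to_finiteDimensional := by
    have h : Module.Finite ℚ (QuadraticAlgebra ℚ d 0) := inferInstance
    convert h

/-- A quadratic field: a number field of degree `2` over `ℚ`. -/
def IsQuadraticField (K : Type*) [Field K] [NumberField K] : Prop :=
  Module.finrank ℚ K = 2

/-- The group `A` appears as a torsion group over `K`: the torsion subgroup of the group `E(K)` of
some elliptic curve `E` over `K` is isomorphic to `A`. -/
def AppearsAsTorsion (A : Type*) [AddCommGroup A] (K : Type*) [Field K] [DecidableEq K] : Prop :=
  ∃ E : WeierstrassCurve K, E.IsElliptic ∧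
    Nonempty (AddCommGroup.torsion E.toAffine.Point ≃+ A)

/-- The elliptic curve `y² - y = x³ - x²`, a model of the modular curve `X₁(11)`. -/
def modularX1_11 (K : Type*) [Field K] : WeierstrassCurve K where
  a₁ := 0
  a₂ := -1
  a₃ := -1
  a₄ := 0
  a₆ := 0

/-- Tate's normal form `Y² + (1 - c) X Y - b Y = X³ - b X²` of an elliptic curve with the marked
point `(0, 0)`. -/
def tateNormalForm {K : Type*} [Field K] (b c : K) : WeierstrassCurve K where
  a₁ := 1 - c
  a₂ := -b
  a₃ := -b
  a₄ := 0
  a₆ := 0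

/-- The modular interpretation of the model `y² - y = x³ - x²` of `X₁(11)`: the point `(x, y)`
with `x ≠ 0` parametrizes the curve in Tate's normal form with
`c = y (y - x) / x` and `b = (1 - y) c`, together with its point `(0, 0)` of order `11`,
provided that this curve is nonsingular. -/
noncomputable def universalCurve11 {K : Type*} [Field K] (x y : K) : WeierstrassCurve K :=
  tateNormalForm ((1 - y) * (y * (y - x) / x)) (y * (y - x) / x)

/-- The cusps of `X₁(11)`: the points of the model that do not parametrize an elliptic curve, that
is, the point at infinity and the points `(x, y)` at which the parametrized curve is undefined or
singular. -/
def IsCusp11 {K : Type*} [Field K] : (modularX1_11 K).toAffine.Point → Prop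
  | .zero => True
  | .some x y _ => x = 0 ∨ (universalCurve11 x y).Δ = 0

/-- The curve
`Y² + (85 + 33√-7)/128 X Y + (85√-7 - 999)/16384 Y = X³ + (89√-7 - 275)/4096 X²`
over `ℚ(√-7)`. -/
noncomputable def explicitCurve11 : WeierstrassCurve (QuadField (-7)) where
  a₁ := (85 + 33 * QuadField.sqrtGen (-7)) / 128
  a₂ := (89 * QuadField.sqrtGen (-7) - 275) / 4096
  a₃ := (85 * QuadField.sqrtGen (-7) - 999) / 16384
  a₄ := 0
  a₆ := 0

/-- Over `K` the curve `X₁(11)` has rank `0`, and its torsion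
subgroup is isomorphic to `ℤ/5ℤ` and consists of cusps. -/
def RankZeroCuspidalTorsion11 (K : Type*) [Field K] [DecidableEq K] : Prop :=
  Module.rank ℤ (modularX1_11 K).toAffine.Point = 0 ∧
    Nonempty (AddCommGroup.torsion (modularX1_11 K).toAffine.Point ≃+ ZMod 5) ∧
    ∀ P ∈ AddCommGroup.torsion (modularX1_11 K).toAffine.Point, IsCusp11 P

/-! Through Tate's normal form, an elliptic curve over `K` with a point of order 11 yields a point
of y² - y = x³ - x² over `K` with x ≠ 0, 1 (`exists_point_of_order_eleven`). A quadratic field with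
|Δ| ≤ 7 is ℚ(i), ℚ(√-3), ℚ(√5) or ℚ(√-7) (`IsQuadraticField.exists_sq_eq`). Hence minimality and the
rank 0 statement both follow once the affine points over the first three fields are known to have x,
y ∈ {0, 1}.

If P is a point over ℚ(√d) with conjugate P̄, then P - P̄ gives a rational point of the twist d w² =
4x³ - 4x² + 1 (`modularX1_11_points`), so everything rests on the rational points of the twists by
1, -1, -3 and 5. These are found by 2-descent in the cubic field ℚ(θ), θ³ - 2θ² + 2 = 0, which
contains half the 2-division polynomial's root: 2x is a root of that cubic when 4x³ - 4x² + 1 = 0.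
The field has class number one and its units of norm 1 are squares or τ = 1 - θ times squares, so
2d(2x - θ) is ξ² or τξ². The second case is impossible 2-adically and the first says that the point
is a double (`exists_half`). Doubling raises the naive height as soon as it is at least 4
(`naiveHeight_lt_of_double`), so halving leads down to finitely many abscissas, which are checked.

Over ℚ(√-7) the origin of the explicit curve has order 11 by direct computation. The torsion has no
further elements because it injects into the reduction modulo the inert prime 3, which has 11 points
over the field of 9 elements (`card_torsion_explicitCurve11_le`). The point of X₁(11) behind this
curve is (-1, (1 + √-7)/2) plus the torsion point (1, 0). The double of the former has abscissa
-4/7, of height 7, and growth of heights under doubling excludes finite order. -/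

open Polynomial NumberField

/-! ## The cubic field of discriminant `-44` -/

/-- The cubic polynomial `X³ - 2X² + 2`. -/
noncomputable def cubicPoly : ℚ[X] := X ^ 3 - 2 * X ^ 2 + 2

namespace CubicField

lemma cubicPoly_eq_map : cubicPoly = (X ^ 3 - 2 * X ^ 2 + 2 : ℤ[X]).map (Int.castRingHom ℚ) := by
  simp [cubicPoly]

lemma natDegree_intPoly : (X ^ 3 - 2 * X ^ 2 + 2 : ℤ[X]).natDegree = 3 := by compute_degree!

lemma monic_intPoly : (X ^ 3 - 2 * X ^ 2 + 2 : ℤ[X]).Monic := by monicity!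

lemma natDegree_cubicPoly : cubicPoly.natDegree = 3 := by
  rw [cubicPoly_eq_map, monic_intPoly.natDegree_map, natDegree_intPoly]

/-- Eisenstein's criterion at 2. -/
lemma irreducible_cubicPoly : Irreducible cubicPoly := by
  rw [cubicPoly_eq_map]
  have h2 : (Ideal.span {(2 : ℤ)}).IsPrime :=
    (Ideal.span_singleton_prime two_ne_zero).mpr Int.prime_two
  have hE : (X ^ 3 - 2 * X ^ 2 + 2 : ℤ[X]).IsEisensteinAt (Ideal.span {(2 : ℤ)}) := by
    refine monic_intPoly.isEisensteinAt_of_mem_of_notMem h2.ne_top ?_ ?_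
    · intro n hn
      rw [natDegree_intPoly] at hn
      rw [Ideal.mem_span_singleton]
      have e : (X ^ 3 - 2 * X ^ 2 + 2 : ℤ[X]) = X ^ 3 - C 2 * X ^ 2 + C 2 := by simp
      rw [e]
      interval_cases n <;> simp
    · rw [Ideal.span_singleton_pow, Ideal.mem_span_singleton]
      have e : (X ^ 3 - 2 * X ^ 2 + 2 : ℤ[X]) = X ^ 3 - C 2 * X ^ 2 + C 2 := by simp
      rw [e]
      simp
  exact (monic_intPoly.irreducible_iff_irreducible_map_fraction_map).mp
    (hE.irreducible h2 monic_intPoly.isPrimitive (by rw [natDegree_intPoly]; norm_num))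

instance : Fact (Irreducible cubicPoly) := ⟨irreducible_cubicPoly⟩

end CubicField

/-- The cubic field `ℚ[X] / (X³ - 2X² + 2)`, of discriminant `-44`. -/
def CubicField : Type := AdjoinRoot cubicPoly

namespace CubicField

noncomputable instance : Field CubicField := inferInstanceAs (Field (AdjoinRoot cubicPoly))

instance : CharZero CubicField :=
  charZero_of_injective_algebraMap (R := ℚ) (A := AdjoinRoot cubicPoly)
    (algebraMap ℚ (AdjoinRoot cubicPoly)).injective

lemma exists_basis : ∃ b : Module.Basis (Fin 3) ℚ CubicField,
    ∀ i, b i = (AdjoinRoot.root cubicPoly : CubicField) ^ (i : ℕ) := by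
  -- The ℚ-algebra structure of `AdjoinRoot` and the one from characteristic zero agree because such
  -- a structure is unique; hence the argument for an arbitrary one.
  have h (i : Algebra ℚ (AdjoinRoot cubicPoly)) :
      ∃ b : @Module.Basis (Fin 3) ℚ (AdjoinRoot cubicPoly) _ _ i.toModule,
      ∀ i, b i = AdjoinRoot.root cubicPoly ^ (i : ℕ) := by
    obtain rfl := Subsingleton.elim (AdjoinRoot.instAlgebra cubicPoly) i
    exact ⟨(AdjoinRoot.powerBasis irreducible_cubicPoly.ne_zero).basis.reindex
      (finCongr (by rw [AdjoinRoot.powerBasis_dim, natDegree_cubicPoly])), fun i => by simp⟩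
  exact h (DivisionRing.toRatAlgebra : Algebra ℚ CubicField)

/-- The generator of the cubic field. -/
noncomputable def θ : CubicField := AdjoinRoot.root cubicPoly

lemma θ_cube : θ ^ 3 = 2 * θ ^ 2 - 2 := by
  have h : AdjoinRoot.mk cubicPoly (X ^ 3 - 2 * X ^ 2 + 2) = 0 := AdjoinRoot.mk_self
  simp only [map_add, map_sub, map_mul, map_pow, AdjoinRoot.mk_X, map_ofNat] at h
  have h' : θ ^ 3 - 2 * θ ^ 2 + 2 = 0 := h
  linear_combination h'

/-- The basis `1, θ, θ²`. -/
noncomputable def basis : Module.Basis (Fin 3) ℚ CubicField := exists_basis.choose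

lemma basis_apply (i : Fin 3) : basis i = θ ^ (i : ℕ) := exists_basis.choose_spec i

instance : FiniteDimensional ℚ CubicField := Module.Finite.of_basis basis

instance : NumberField CubicField where
  to_charZero := inferInstance
  to_finiteDimensional := inferInstance

lemma finrank_eq : Module.finrank ℚ CubicField = 3 := by
  rw [Module.finrank_eq_card_basis basis, Fintype.card_fin]

/-- The element `r + sθ + tθ²`. -/
noncomputable def lin (r s t : ℚ) : CubicField := r + s * θ + t * θ ^ 2

lemma lin_eq_sum (r s t : ℚ) : lin r s t = r • basis 0 + s • basis 1 + t • basis 2 := by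
  simp [lin, basis_apply, Algebra.smul_def]

lemma repr_lin (r s t : ℚ) (i : Fin 3) : basis.repr (lin r s t) i = ![r, s, t] i := by
  rw [lin_eq_sum]
  fin_cases i <;> simp

lemma exists_lin (x : CubicField) : ∃ r s t, x = lin r s t := by
  refine ⟨basis.repr x 0, basis.repr x 1, basis.repr x 2, ?_⟩
  rw [lin_eq_sum]
  conv_lhs => rw [← basis.sum_repr x]
  rw [Fin.sum_univ_three]

lemma lin_injective {r s t r' s' t' : ℚ} (h : lin r s t = lin r' s' t') :
    r = r' ∧ s = s' ∧ t = t' := by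
  have h0 := fun i => (repr_lin r s t i).symm.trans ((congrArg (fun z => basis.repr z i) h).trans
    (repr_lin r' s' t' i))
  exact ⟨by simpa using h0 0, by simpa using h0 1, by simpa using h0 2⟩

lemma lin_mul_θ (r s t : ℚ) : lin r s t * θ = lin (-2 * t) r (s + 2 * t) := by
  simp only [lin]; push_cast
  linear_combination (t : CubicField) * θ_cube

lemma lin_mul_θ_sq (r s t : ℚ) :
    lin r s t * θ ^ 2 = lin (-2 * (s + 2 * t)) (-2 * t) (r + 2 * (s + 2 * t)) := by
  rw [pow_two, ← mul_assoc, lin_mul_θ, lin_mul_θ]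

lemma leftMulMatrix_lin (r s t : ℚ) : Algebra.leftMulMatrix basis (lin r s t) =
    !![r, -2 * t, -2 * (s + 2 * t); s, r, -2 * t; t, s + 2 * t, r + 2 * (s + 2 * t)] := by
  ext i j
  rw [Algebra.leftMulMatrix_eq_repr_mul, basis_apply]
  fin_cases j
  · simp only [Fin.zero_eta, pow_zero, mul_one, repr_lin]
    fin_cases i <;> rfl
  · simp only [Fin.mk_one, pow_one, lin_mul_θ, repr_lin]
    fin_cases i <;> rfl
  · simp only [Fin.reduceFinMk, lin_mul_θ_sq, repr_lin]
    fin_cases i <;> rfl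

lemma norm_lin (r s t : ℚ) : Algebra.norm ℚ (lin r s t) =
    r * (r * (r + 2 * (s + 2 * t)) + 2 * t * (s + 2 * t)) +
    2 * t * (s * (r + 2 * (s + 2 * t)) + 2 * t ^ 2) -
    2 * (s + 2 * t) * (s * (s + 2 * t) - r * t) := by
  rw [Algebra.norm_eq_matrix_det basis, leftMulMatrix_lin, Matrix.det_fin_three]
  simp
  ring

lemma trace_lin (r s t : ℚ) : Algebra.trace ℚ CubicField (lin r s t) = 3 * r + 2 * s + 4 * t := by
  rw [Algebra.trace_eq_matrix_trace basis, leftMulMatrix_lin, Matrix.trace_fin_three]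
  simp
  ring

lemma norm_sub_mul_θ (a b : ℚ) :
    Algebra.norm ℚ ((a : CubicField) - b * θ) = a ^ 3 - 2 * a ^ 2 * b + 2 * b ^ 3 := by
  have : (a : CubicField) - b * θ = lin a (-b) 0 := by simp [lin]; ring
  rw [this, norm_lin]; ring

lemma discr_basis : Algebra.discr ℚ basis = -44 := by
  have h : ∀ i j : Fin 3, Algebra.traceForm ℚ CubicField (basis i) (basis j) =
      !![(3:ℚ), 2, 4; 2, 4, 2; 4, 2, 0] i j := by
    intro i j
    rw [Algebra.traceForm_apply, basis_apply, basis_apply, ← pow_add]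
    have e0 : θ ^ 0 = lin 1 0 0 := by simp [lin]
    have e1 : θ ^ 1 = lin 0 1 0 := by simp [lin]
    have e2 : θ ^ 2 = lin 0 0 1 := by simp [lin]
    have e3 : θ ^ 3 = lin (-2) 0 2 := by simp [lin, θ_cube]; ring
    have e4 : θ ^ 4 = lin (-4) (-2) 4 := by
      simp [lin]; linear_combination (θ + 2) * θ_cube
    fin_cases i <;> fin_cases j <;>
      simp [e0, e1, e2, e3, e4, trace_lin, -pow_one, -pow_zero] <;> norm_num
  rw [Algebra.discr_def]
  have : Algebra.traceMatrix ℚ basis = !![(3:ℚ), 2, 4; 2, 4, 2; 4, 2, 0] := by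
    ext i j; exact h i j
  rw [this, Matrix.det_fin_three]
  simp; norm_num

end CubicField

/-! ### Discriminant, class number and units of the cubic field -/

/-- The discriminant of a family of `[K : ℚ]` integral elements is the discriminant of `K` times
a square. -/
lemma NumberField.exists_discr_eq_sq_mul {K : Type*} [Field K] [NumberField K] {ι : Type*}
    [Fintype ι] [DecidableEq ι] (e : ι → K) (he : ∀ i, IsIntegral ℤ (e i))
    (hcard : Fintype.card ι = Module.finrank ℚ K) :
    ∃ k : ℤ, Algebra.discr ℚ e = k ^ 2 * (discr K : ℚ) := by
  classical
  have hc : Fintype.card (Module.Free.ChooseBasisIndex ℤ (𝓞 K)) = Fintype.card ι := by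
    rw [hcard, ← RingOfIntegers.rank, Module.finrank_eq_card_chooseBasisIndex]
  let f := Fintype.equivOfCardEq hc
  let b := (integralBasis K).reindex f
  let P : Matrix ι ι ℤ := fun i j => (RingOfIntegers.basis K).repr ⟨e j, he j⟩ (f.symm i)
  have hP : b.toMatrix e = P.map (Int.castRingHom ℚ) := by
    ext i j
    simp only [Module.Basis.toMatrix_apply, b, P, Module.Basis.repr_reindex_apply]
    exact integralBasis_repr_apply K ⟨e j, he j⟩ (f.symm i)
  refine ⟨P.det, ?_⟩
  have h := Algebra.discr_of_matrix_vecMul (A := ℚ) b (b.toMatrix e)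
  rw [Module.Basis.toMatrix_map_vecMul, hP, ← RingHom.mapMatrix_apply, ← RingHom.map_det] at h
  rw [h, coe_discr, ← Algebra.discr_reindex ℚ (integralBasis K) f]
  have : (⇑(integralBasis K) ∘ ⇑f.symm) = b := by ext; simp [b]
  rw [this]
  rfl

namespace CubicField

lemma isIntegral_θ : IsIntegral ℤ θ := by
  refine ⟨X ^ 3 - 2 * X ^ 2 + 2, monic_intPoly, ?_⟩
  simp [θ_cube]

/-- The index of ℤ[θ] is never computed: this relation bounds the discriminant and fixes its sign,
which is enough for Minkowski's bound and for the unit rank. -/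
lemma exists_discr_eq : ∃ k : ℤ, -44 = k ^ 2 * discr CubicField := by
  obtain ⟨k, hk⟩ := exists_discr_eq_sq_mul basis
    (fun i => by rw [basis_apply]; exact isIntegral_θ.pow _) (by rw [finrank_eq, Fintype.card_fin])
  rw [discr_basis] at hk
  exact ⟨k, by exact_mod_cast hk⟩

lemma abs_discr_le : |discr CubicField| ≤ 44 := by
  obtain ⟨k, hk⟩ := exists_discr_eq
  have hk0 : k ≠ 0 := by rintro rfl; simp at hk
  have h1 : 1 ≤ k ^ 2 := by have := sq_pos_of_ne_zero hk0; omega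
  rw [abs_le]
  constructor <;> nlinarith

lemma discr_neg : discr CubicField < 0 := by
  obtain ⟨k, hk⟩ := exists_discr_eq
  nlinarith [sq_nonneg k]

lemma nrComplexPlaces_eq : InfinitePlace.nrComplexPlaces CubicField = 1 := by
  have h := sign_discr CubicField
  rw [Int.sign_eq_neg_one_of_neg discr_neg] at h
  have h2 := InfinitePlace.card_add_two_mul_card_eq_rank CubicField
  rw [finrank_eq] at h2
  have h3 : InfinitePlace.nrComplexPlaces CubicField ≤ 1 := by omega
  interval_cases InfinitePlace.nrComplexPlaces CubicField
  · simp at h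
  · rfl

lemma rank_eq : Units.rank CubicField = 1 := by
  have h2 := InfinitePlace.card_add_two_mul_card_eq_rank CubicField
  rw [finrank_eq, nrComplexPlaces_eq] at h2
  rw [Units.rank, InfinitePlace.card_eq_nrRealPlaces_add_nrComplexPlaces, nrComplexPlaces_eq]
  omega

instance : IsPrincipalIdealRing (𝓞 CubicField) := by
  -- For degree 3 and one complex place Minkowski's criterion asks for |Δ| < (9π/4)² ≈ 49.9, and |Δ|
  -- ≤ 44.
  apply RingOfIntegers.isPrincipalIdealRing_of_abs_discr_lt
  rw [nrComplexPlaces_eq, finrank_eq]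
  have h : ((|discr CubicField| : ℤ) : ℝ) ≤ 44 := by exact_mod_cast abs_discr_le
  have hpi := Real.pi_gt_d2
  have h6 : ((Nat.factorial 3 : ℕ) : ℝ) = 6 := by norm_num [Nat.factorial]
  rw [h6]
  push_cast at h ⊢
  nlinarith

/-- `θ` as an algebraic integer. -/
noncomputable def θI : 𝓞 CubicField := ⟨θ, isIntegral_θ⟩

lemma coe_θI : (θI : CubicField) = θ := rfl

lemma θI_cube : θI ^ 3 = 2 * θI ^ 2 - 2 := by
  apply RingOfIntegers.coe_injective
  simp only [map_pow, map_sub, map_mul, map_ofNat, coe_θI]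
  exact θ_cube

/-- The unit `1 - θ`. -/
noncomputable def τ : (𝓞 CubicField)ˣ where
  val := 1 - θI
  inv := θI ^ 2 - θI - 1
  val_inv := by linear_combination -θI_cube
  inv_val := by linear_combination -θI_cube

lemma coe_τ : ((τ : 𝓞 CubicField) : CubicField) = 1 - θ := by
  simp [τ, coe_θI]

lemma norm_τ : Algebra.norm ℚ ((τ : 𝓞 CubicField) : CubicField) = 1 := by
  have := norm_sub_mul_θ 1 1
  rw [coe_τ]
  norm_num at this
  exact this

lemma norm_unit (v : (𝓞 CubicField)ˣ) : Algebra.norm ℚ ((v : 𝓞 CubicField) : CubicField) = 1 ∨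
    Algebra.norm ℚ ((v : 𝓞 CubicField) : CubicField) = -1 := by
  have h := (NumberField.isUnit_iff_norm (x := (v : 𝓞 CubicField))).mp v.isUnit
  rw [RingOfIntegers.coe_norm] at h
  exact eq_or_eq_neg_of_abs_eq h

lemma norm_neg (x : CubicField) : Algebra.norm ℚ (-x) = -Algebra.norm ℚ x := by
  have : -x = algebraMap ℚ CubicField (-1) * x := by simp
  rw [this, map_mul, Algebra.norm_algebraMap, finrank_eq]; norm_num

lemma lin_mul_self (r s t : ℚ) : lin r s t * lin r s t =
    lin (r ^ 2 - 4 * s * t - 4 * t ^ 2) (2 * r * s - 2 * t ^ 2)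
      (s ^ 2 + 2 * r * t + 4 * s * t + 4 * t ^ 2) := by
  simp only [lin]; push_cast
  linear_combination ((t : CubicField) ^ 2 * θ + 2 * t ^ 2 + 2 * s * t) * θ_cube

/-- A root would have numerator and then denominator even. The quartic arises when the point with
v-coordinate 1 on z² = v³ - 2v² + 2 is halved, see `τ_not_square`. -/
lemma quartic_ne_zero (u : ℚ) : u ^ 4 - 4 * u ^ 3 + 8 * u ^ 2 - 16 * u + 8 ≠ 0 := by
  intro h
  have hq : (u.den : ℚ) ≠ 0 := by exact_mod_cast u.den_ne_zero
  have hu : u * u.den = u.num := Rat.mul_den_eq_num u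
  have hi : u.num ^ 4 - 4 * u.num ^ 3 * u.den + 8 * u.num ^ 2 * u.den ^ 2
      - 16 * u.num * u.den ^ 3 + 8 * (u.den : ℤ) ^ 4 = 0 := by
    have : (u.num : ℚ) ^ 4 - 4 * u.num ^ 3 * u.den + 8 * u.num ^ 2 * u.den ^ 2
      - 16 * u.num * u.den ^ 3 + 8 * (u.den : ℚ) ^ 4 = 0 := by
      rw [← hu]; linear_combination (u.den : ℚ) ^ 4 * h
    exact_mod_cast this
  have h2 : (2 : ℤ) ∣ u.num := by
    apply Int.prime_two.dvd_of_dvd_pow (n := 4)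
    exact ⟨2 * u.num ^ 3 * u.den - 4 * u.num ^ 2 * u.den ^ 2 + 8 * u.num * u.den ^ 3
      - 4 * (u.den : ℤ) ^ 4, by linear_combination hi⟩
  obtain ⟨k, hk⟩ := h2
  rw [hk] at hi
  have h3 : (2 : ℤ) ∣ u.den := by
    apply Int.prime_two.dvd_of_dvd_pow (n := 4)
    exact ⟨-k ^ 4 + 2 * k ^ 3 * u.den - 2 * k ^ 2 * u.den ^ 2 + 2 * k * u.den ^ 3, by
      linarith⟩
  have hc : IsCoprime u.num (u.den : ℤ) := Rat.isCoprime_num_den u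
  have := hc.isUnit_of_dvd' ⟨k, hk⟩ h3
  exact Int.prime_two.not_isUnit this

/-- Rational solutions of the equations for a square with vanishing `θ²`-coefficient. -/
lemma duplication_of_sq {r s t e A : ℚ} (he : e ≠ 0)
    (h2 : s ^ 2 + 2 * r * t + 4 * s * t + 4 * t ^ 2 = 0) (h1 : 2 * r * s - 2 * t ^ 2 = -e)
    (h0 : r ^ 2 - 4 * s * t - 4 * t ^ 2 = A) :
    ∃ v z : ℚ, z ≠ 0 ∧ e * z ^ 2 = v ^ 3 - 2 * v ^ 2 + 2 ∧
      4 * z ^ 2 * A = v ^ 4 - 16 * v + 16 := by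
  have ht : t ≠ 0 := by
    rintro rfl
    have : s = 0 := by simpa using h2
    subst this
    apply he; linarith
  -- This v is chosen so that (r + sθ + tθ²)(v - θ) has no θ²-term. Squaring that linear expression
  -- gives the line tangent at abscissa v and passing through abscissa A/e, whence the duplication
  -- formula.
  refine ⟨s / t + 2, 1 / t, by positivity, ?_, ?_⟩
  · field_simp
    linear_combination t * h1 - s * h2
  · rw [← h0]
    have hr : r = -(s ^ 2 + 4 * s * t + 4 * t ^ 2) / (2 * t) := by
      field_simp; linear_combination h2
    rw [hr]
    field_simp
    ring

lemma τ_not_square (w : CubicField) : w * w ≠ 1 - θ := by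
  intro h
  obtain ⟨r, s, t, rfl⟩ := exists_lin w
  have e1 : (1 : CubicField) - θ = lin 1 (-1) 0 := by simp [lin]; ring
  rw [lin_mul_self, e1] at h
  obtain ⟨h0, h1, h2⟩ := lin_injective h
  obtain ⟨v, z, -, hz1, hz2⟩ := duplication_of_sq one_ne_zero h2 h1 h0
  apply quartic_ne_zero v
  linear_combination 4 * hz1 - hz2

/-- Dirichlet's theorem in rank 1. The degree is odd, so the only roots of unity are ±1 and -1 has
norm -1; a change of sign gives the generator norm 1 and then removes the sign from all units of
norm 1. -/
lemma exists_fundamental : ∃ η : (𝓞 CubicField)ˣ,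
    Algebra.norm ℚ ((η : 𝓞 CubicField) : CubicField) = 1 ∧
    ∀ v : (𝓞 CubicField)ˣ, Algebra.norm ℚ ((v : 𝓞 CubicField) : CubicField) = 1 →
      ∃ k : ℤ, v = η ^ k := by
  have hN (x y : (𝓞 CubicField)ˣ) : Algebra.norm ℚ (((x * y : (𝓞 CubicField)ˣ) : 𝓞 CubicField) :
      CubicField) = Algebra.norm ℚ ((x : 𝓞 CubicField) : CubicField) *
        Algebra.norm ℚ ((y : 𝓞 CubicField) : CubicField) := by
    rw [Units.val_mul, ← map_mul]; congr 1
  have hneg (x : (𝓞 CubicField)ˣ) : Algebra.norm ℚ (((-x : (𝓞 CubicField)ˣ) : 𝓞 CubicField) :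
      CubicField) = - Algebra.norm ℚ ((x : 𝓞 CubicField) : CubicField) := by
    rw [← norm_neg]; congr 1
  have i0 : Fin (Units.rank CubicField) := ⟨0, by rw [rank_eq]; norm_num⟩
  let η₀ := Units.fundSystem CubicField i0
  have hall (v : (𝓞 CubicField)ˣ) : ∃ k : ℤ, v = η₀ ^ k ∨ v = -η₀ ^ k := by
    obtain ⟨⟨ζ, e⟩, h, -⟩ := Units.exist_unique_eq_mul_prod CubicField v
    have hp : ∏ i, (Units.fundSystem CubicField i) ^ (e i) = η₀ ^ e i0 :=
      Fintype.prod_eq_single i0 fun i hi => absurd (Fin.ext (by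
        have := i.2; have := i0.2; have := rank_eq; omega)) hi
    simp only [hp] at h
    refine ⟨e i0, ?_⟩
    rcases Units.torsion_eq_one_or_neg_one_of_odd_finrank
      (by rw [finrank_eq]; decide) ζ with hζ | hζ
    · left; rw [h, hζ, one_mul]
    · right; rw [h, hζ, neg_one_mul]
  obtain ⟨η, hη, hall'⟩ : ∃ η : (𝓞 CubicField)ˣ,
      Algebra.norm ℚ ((η : 𝓞 CubicField) : CubicField) = 1 ∧
      ∀ v : (𝓞 CubicField)ˣ, ∃ k : ℤ, v = η ^ k ∨ v = -η ^ k := by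
    rcases norm_unit η₀ with h | h
    · exact ⟨η₀, h, hall⟩
    · refine ⟨-η₀, by rw [hneg, h, neg_neg], fun v => ?_⟩
      obtain ⟨k, hk⟩ := hall v
      refine ⟨k, ?_⟩
      rcases Int.even_or_odd k with he | ho
      · rwa [he.neg_zpow]
      · rw [ho.neg_zpow, neg_neg]; exact hk.symm
  have hpow (k : ℤ) : Algebra.norm ℚ (((η ^ k : (𝓞 CubicField)ˣ) : 𝓞 CubicField) :
      CubicField) = 1 := by
    let φ : (𝓞 CubicField)ˣ →* ℚ :=
      { toFun := fun x => Algebra.norm ℚ ((x : 𝓞 CubicField) : CubicField)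
        map_one' := by simp
        map_mul' := hN }
    have h1 : φ.toHomUnits η = 1 := Units.ext hη
    have h2 : φ.toHomUnits (η ^ k) = 1 := by rw [map_zpow, h1, one_zpow]
    exact congrArg Units.val h2
  refine ⟨η, hη, fun v hv => ?_⟩
  obtain ⟨k, hk | hk⟩ := hall' v
  · exact ⟨k, hk⟩
  · rw [hk, hneg, hpow] at hv
    norm_num at hv

/-- Since τ is not a square, it is an odd power of the fundamental unit and can replace it modulo
squares. It need not be shown to be fundamental. -/
lemma unit_eq_sq_or (v : (𝓞 CubicField)ˣ)
    (hv : Algebra.norm ℚ ((v : 𝓞 CubicField) : CubicField) = 1) :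
    ∃ w : (𝓞 CubicField)ˣ, v = w ^ 2 ∨ v = τ * w ^ 2 := by
  obtain ⟨η, -, h⟩ := exists_fundamental
  obtain ⟨k, rfl⟩ := h v hv
  obtain ⟨a, ha⟩ := h τ norm_τ
  have ha' : Odd a := by
    rw [← Int.not_even_iff_odd]
    rintro ⟨c, rfl⟩
    apply τ_not_square (((η ^ c : (𝓞 CubicField)ˣ) : 𝓞 CubicField) : CubicField)
    rw [← coe_τ, ha, zpow_add, Units.val_mul]
    exact (map_mul (algebraMap (𝓞 CubicField) CubicField) _ _).symm
  rcases Int.even_or_odd k with ⟨c, rfl⟩ | hk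
  · exact ⟨η ^ c, Or.inl (by rw [zpow_add, pow_two])⟩
  · obtain ⟨c, hc⟩ := hk.sub_odd ha'
    refine ⟨η ^ c, Or.inr ?_⟩
    rw [ha, pow_two, ← zpow_add, ← zpow_add, ← hc]
    congr 1; ring

end CubicField

/-! ### Factorization of a - bθ and the local obstruction -/

namespace CubicField

/-- Its norm -2 is prime up to sign. -/
lemma prime_θI : Prime θI := by
  have hn : Algebra.norm ℤ θI = -2 := by
    have h : ((Algebra.norm ℤ θI : ℤ) : ℚ) = -2 := by
      rw [Algebra.coe_norm_int, coe_θI]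
      have : θ = lin 0 1 0 := by simp [lin]
      rw [this, norm_lin]; norm_num
    exact_mod_cast h
  have h0 : θI ≠ 0 := by rintro h; rw [h] at hn; simp at hn
  rw [← Ideal.span_singleton_prime h0]
  apply Ideal.isPrime_of_irreducible_absNorm
  rw [Ideal.absNorm_span_singleton, hn]
  exact Nat.prime_two

/-- The second hypothesis concerns the cofactor of a - bt in the cubic form; at a = bt it becomes b²
times t(3t - 4), the derivative of the cubic at t. -/
lemma dvd_cofactor_of_prime_dvd {R : Type*} [CommRing R] {π a b t : R} (h1 : π ∣ a - b * t)
    (h2 : π ∣ a ^ 2 + a * b * (t - 2) + b ^ 2 * (t ^ 2 - 2 * t)) :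
    π ∣ b ^ 2 * (t * (3 * t - 4)) := by
  have : b ^ 2 * (t * (3 * t - 4)) = (a ^ 2 + a * b * (t - 2) + b ^ 2 * (t ^ 2 - 2 * t)) -
      (a - b * t) * (a + b * (2 * t - 2)) := by ring
  rw [this]
  exact dvd_sub h2 (h1.mul_right _)

/-- Modulo 11 the cubic is (X - 5)²(X - 3). The double root does not lift modulo 121: the value at 5
is 77 and the derivative there is 55. -/
lemma eleven_dvd_sub {a b : ℤ} (h : (121 : ℤ) ∣ a ^ 3 - 2 * a ^ 2 * b + 2 * b ^ 3)
    (hb : ¬ (11 : ℤ) ∣ b) : (11 : ℤ) ∣ a - 3 * b := by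
  have p11 : Prime (11 : ℤ) := by norm_num
  have h11 : (11 : ℤ) ∣ (a - 5 * b) ^ 2 * (a - 3 * b) := by
    have e : (a - 5 * b) ^ 2 * (a - 3 * b) = (a ^ 3 - 2 * a ^ 2 * b + 2 * b ^ 3) +
      11 * (-a ^ 2 * b + 5 * a * b ^ 2 - 7 * b ^ 3) := by ring
    rw [e]
    exact dvd_add ((by norm_num : (11 : ℤ) ∣ 121).trans h) (dvd_mul_right _ _)
  rcases p11.dvd_or_dvd h11 with h5 | h3
  · exfalso
    obtain ⟨k, hk⟩ := p11.dvd_of_dvd_pow h5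
    obtain ⟨l, hl⟩ := h
    have ha : a = 5 * b + 11 * k := by linarith
    apply hb
    apply p11.dvd_of_dvd_pow (n := 3)
    have e : 7 * b ^ 3 = 11 * (l - k ^ 2 * (13 * b + 11 * k) - 5 * b ^ 2 * k) := by
      rw [ha] at hl
      linarith
    exact (Int.isCoprime_iff_gcd_eq_one.mpr (by decide) : IsCoprime (11 : ℤ) 7).dvd_of_dvd_mul_left
      ⟨_, e⟩
  · exact h3

lemma intCast_isCoprime {a b : ℤ} (h : IsCoprime a b) :
    IsCoprime (a : 𝓞 CubicField) (b : 𝓞 CubicField) := by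
  simpa using h.map (Int.castRingHom (𝓞 CubicField))

/-- A common prime divides the derivative, hence 3θ - 4, which has norm 22. As c is odd, it lies
above 11 and 11 divides c. Then the square c² forces a ≡ 3b modulo 11, the simple root, whereas 3θ -
4 belongs to the double root 5; the two are incompatible. -/
lemma isCoprime_cofactor {a b c : ℤ} (hc : Odd c) (hbc : IsCoprime b c)
    (hN : c ^ 2 ∣ a ^ 3 - 2 * a ^ 2 * b + 2 * b ^ 3) {π : 𝓞 CubicField} (hπ : Prime π)
    (hπc : π ∣ c) (h1 : π ∣ a - b * θI) :
    ¬ π ∣ a ^ 2 + a * b * (θI - 2) + b ^ 2 * (θI ^ 2 - 2 * θI) := by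
  intro h2
  have notdvd {x : ℤ} (hx : IsCoprime x c) : ¬ π ∣ x := fun h =>
    hπ.not_isUnit ((intCast_isCoprime hx).isUnit_of_dvd' h hπc)
  have hb : ¬ π ∣ b := notdvd hbc
  have hc2 : IsCoprime (2 : ℤ) c := Int.isCoprime_two_left.mpr hc
  have h2' : ¬ π ∣ 2 := by simpa using notdvd hc2
  have hθ : ¬ π ∣ θI := fun h => h2' (h.trans ⟨θI * (2 - θI), by
    linear_combination θI_cube⟩)
  have h3 := dvd_cofactor_of_prime_dvd h1 h2
  have h4 : π ∣ 3 * θI - 4 := by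
    rcases hπ.dvd_or_dvd h3 with h | h
    · exact absurd (hπ.dvd_of_dvd_pow h) hb
    · exact (hπ.dvd_or_dvd h).resolve_left hθ
  have h22 : π ∣ 2 * 11 := h4.trans ⟨-(3 * θI - 4) * (3 * θI + 2), by
    linear_combination 27 * θI_cube⟩
  have h11 : π ∣ 11 := (hπ.dvd_or_dvd h22).resolve_left h2'
  by_cases hc11 : (11 : ℤ) ∣ c
  · have h121 : (121 : ℤ) ∣ a ^ 3 - 2 * a ^ 2 * b + 2 * b ^ 3 :=
      (by simpa using pow_dvd_pow_of_dvd hc11 2 : (121 : ℤ) ∣ c ^ 2).trans hN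
    have hb11 : ¬ (11 : ℤ) ∣ b := fun h => by
      have := hbc.isUnit_of_dvd' h hc11
      rw [Int.isUnit_iff] at this; omega
    obtain ⟨l, hl⟩ := eleven_dvd_sub h121 hb11
    have hl' : (a : 𝓞 CubicField) - 3 * b = 11 * l := by exact_mod_cast congrArg (Int.cast) hl
    have h5 : π ∣ b * (3 - θI) := by
      have : b * (3 - θI) = (a - b * θI) - 11 * l := by linear_combination -hl'
      rw [this]; exact dvd_sub h1 (h11.mul_right _)
    have h6 := (hπ.dvd_or_dvd h5).resolve_left hb
    have h7 : π ∣ 1 := by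
      have : (1 : 𝓞 CubicField) = 11 - 2 * ((3 * θI - 4) + 3 * (3 - θI)) := by ring
      rw [this]
      exact dvd_sub h11 ((dvd_add h4 (h6.mul_left _)).mul_left _)
    exact hπ.not_isUnit (isUnit_of_dvd_one h7)
  · have p11 : Prime (11 : ℤ) := by norm_num
    have := notdvd ((Prime.coprime_iff_not_dvd p11).mpr hc11)
    exact this (by simpa using h11)

/-- The class group and the units of the cubic field enter here: an element `a - bθ` whose norm is
a square up to sign and powers of `2` is a square up to units and powers of `θ`. -/
lemma exists_eq_unit_mul_sq {a b c : ℤ} {s : ℤ} {j : ℕ} (hs : IsUnit s) (hc : Odd c)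
    (hbc : IsCoprime b c) (hN : a ^ 3 - 2 * a ^ 2 * b + 2 * b ^ 3 = s * 2 ^ j * c ^ 2) :
    ∃ (v : (𝓞 CubicField)ˣ) (e : ℕ) (γ : 𝓞 CubicField), a - b * θI = v * θI ^ e * γ ^ 2 := by
  set α : 𝓞 CubicField := a - b * θI with hα
  set α' : 𝓞 CubicField := a ^ 2 + a * b * (θI - 2) + b ^ 2 * (θI ^ 2 - 2 * θI) with hα'
  have hNR : α * α' = s * 2 ^ j * c ^ 2 := by
    have h : ((a ^ 3 - 2 * a ^ 2 * b + 2 * b ^ 3 : ℤ) : 𝓞 CubicField) =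
        ((s * 2 ^ j * c ^ 2 : ℤ) : 𝓞 CubicField) := by rw [hN]
    push_cast at h
    rw [← h, hα, hα']
    linear_combination -(b : 𝓞 CubicField) ^ 3 * θI_cube
  have hc0 : (c : 𝓞 CubicField) ≠ 0 := by
    rintro h
    have : c = 0 := by exact_mod_cast h
    subst this; simp at hc
  -- The gcd γ of α and c is the wanted square root. It is coprime to α', so γ² divides α, and κ =
  -- α/γ² divides s 2^j, hence a power of the prime θ.
  obtain ⟨γ, hγ⟩ := (IsPrincipalIdealRing.principal (Ideal.span {α, (c : 𝓞 CubicField)})).principal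
  replace hγ : Ideal.span {α, (c : 𝓞 CubicField)} = Ideal.span {γ} := hγ
  have hγα : γ ∣ α := Ideal.mem_span_singleton.mp (hγ ▸ Ideal.subset_span (by simp))
  have hγc : γ ∣ c := Ideal.mem_span_singleton.mp (hγ ▸ Ideal.subset_span (by simp))
  have hγm : γ ∈ Ideal.span {α, (c : 𝓞 CubicField)} := by
    rw [hγ]; exact Ideal.mem_span_singleton_self γ
  obtain ⟨x, y, hxy⟩ := Ideal.mem_span_pair.mp hγm
  have hγ0 : γ ≠ 0 := by rintro rfl; exact hc0 (zero_dvd_iff.mp hγc)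
  have hcop : IsCoprime γ α' := by
    apply isCoprime_of_prime_dvd (fun h => hγ0 h.1)
    intro π hπ hπγ
    exact isCoprime_cofactor hc hbc ⟨s * 2 ^ j, by rw [hN]; ring⟩ hπ (hπγ.trans hγc) (hπγ.trans hγα)
  obtain ⟨α₁, hα₁⟩ := hγα
  obtain ⟨c₁, hc₁⟩ := hγc
  have hcop₁ : IsCoprime α₁ c₁ := ⟨x, y, mul_left_cancel₀ hγ0 (by
    rw [mul_one]; linear_combination hxy - x * hα₁ - y * hc₁)⟩
  have h1 : α₁ * α' = s * 2 ^ j * γ * c₁ ^ 2 := mul_left_cancel₀ hγ0 (by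
    linear_combination hNR - α' * hα₁ + s * 2 ^ j * (c + γ * c₁) * hc₁)
  obtain ⟨κ, hκ⟩ : γ ∣ α₁ := hcop.dvd_of_dvd_mul_right ⟨s * 2 ^ j * c₁ ^ 2, by rw [h1]; ring⟩
  have h2 : κ * α' = s * 2 ^ j * c₁ ^ 2 := mul_left_cancel₀ hγ0 (by
    linear_combination h1 - α' * hκ)
  have hκ2 : κ ∣ s * 2 ^ j := by
    have : IsCoprime κ (c₁ ^ 2) := (hcop₁.of_isCoprime_of_dvd_left ⟨γ, by rw [hκ]; ring⟩).pow_right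
    exact this.dvd_of_dvd_mul_right ⟨α', h2.symm⟩
  have hsR : IsUnit (s : 𝓞 CubicField) := by simpa using hs.map (Int.castRingHom (𝓞 CubicField))
  have hκθ : κ ∣ θI ^ (3 * j) := by
    refine ((hsR.dvd_mul_left).mp hκ2).trans ?_
    rw [pow_mul]
    exact pow_dvd_pow_of_dvd ⟨θI ^ 2 - 1, by linear_combination θI_cube⟩ j
  obtain ⟨e, -, v, hv⟩ := (dvd_prime_pow prime_θI _).mp hκθ
  refine ⟨v⁻¹, e, γ, ?_⟩
  rw [hα₁, hκ, ← hv]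
  linear_combination (-γ ^ 2 * κ) * v.inv_mul

/-- There is no `2`-adic solution of the equations for `τ` times a square. -/
lemma eq_zero_of_two_adic {d : ℤ} (hd : Odd d) : ∀ (N : ℕ) (D R S T : ℤ), D.natAbs ≤ N →
    S ^ 2 + 2 * R * S + 2 * R * T + 4 * S * T + 2 * T ^ 2 = 0 →
    R ^ 2 - 2 * R * S - 4 * S * T - 2 * T ^ 2 = 2 * d * D ^ 2 → D = 0 := by
  intro N
  -- Infinite descent: the equations force 2 to divide S, R, T and D, in this order, and the
  -- homogeneous equations persist for the halves.
  induction N with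
  | zero => intro D R S T hD _ _; simpa using hD
  | succ N ih =>
    intro D R S T hD h1 h2
    have p2 := Int.prime_two
    obtain ⟨S, rfl⟩ : (2 : ℤ) ∣ S := p2.dvd_of_dvd_pow (n := 2)
      ⟨-(R * S + R * T + 2 * S * T + T ^ 2), by linarith⟩
    obtain ⟨R, rfl⟩ : (2 : ℤ) ∣ R := p2.dvd_of_dvd_pow (n := 2)
      ⟨d * D ^ 2 + R * (2 * S) + 2 * (2 * S) * T + T ^ 2, by linarith⟩
    obtain ⟨T, rfl⟩ : (2 : ℤ) ∣ T := p2.dvd_of_dvd_pow (n := 2)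
      ⟨-(S ^ 2 + 2 * R * S + R * T + 2 * S * T), by linarith⟩
    obtain ⟨D, rfl⟩ : (2 : ℤ) ∣ D := by
      have : (2 : ℤ) ∣ d * D ^ 2 :=
        ⟨R ^ 2 - 2 * R * S - 4 * S * T - 2 * T ^ 2, by linarith⟩
      rcases p2.dvd_or_dvd this with h | h
      · exact absurd h (Int.two_dvd_ne_zero.mpr (Int.odd_iff.mp hd))
      · exact p2.dvd_of_dvd_pow h
    by_cases hD0 : D = 0
    · simp [hD0]
    have := ih D R S T (by rw [Int.natAbs_mul] at hD; have := Int.natAbs_pos.mpr hD0; norm_num at hD; omega)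
      (by linarith) (by linarith)
    simp [this]

lemma no_rational_two_adic {d : ℤ} (hd : Odd d) (r s t : ℚ)
    (h1 : s ^ 2 + 2 * r * s + 2 * r * t + 4 * s * t + 2 * t ^ 2 = 0)
    (h2 : r ^ 2 - 2 * r * s - 4 * s * t - 2 * t ^ 2 = 2 * d) : False := by
  have hr := Rat.mul_den_eq_num r
  have hs := Rat.mul_den_eq_num s
  have ht := Rat.mul_den_eq_num t
  have := eq_zero_of_two_adic hd _ (r.den * s.den * t.den) (r.num * s.den * t.den)
    (s.num * r.den * t.den) (t.num * r.den * s.den) le_rfl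
    (by
      have : (((s.num * r.den * t.den : ℤ) : ℚ)) ^ 2 + 2 * ((r.num * s.den * t.den : ℤ) : ℚ) *
          ((s.num * r.den * t.den : ℤ) : ℚ) + 2 * ((r.num * s.den * t.den : ℤ) : ℚ) *
          ((t.num * r.den * s.den : ℤ) : ℚ) + 4 * ((s.num * r.den * t.den : ℤ) : ℚ) *
          ((t.num * r.den * s.den : ℤ) : ℚ) + 2 * ((t.num * r.den * s.den : ℤ) : ℚ) ^ 2 = 0 := by
        push_cast
        rw [← hr, ← hs, ← ht]
        linear_combination (r.den * s.den * t.den : ℚ) ^ 2 * h1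
      exact_mod_cast this)
    (by
      have : ((r.num * s.den * t.den : ℤ) : ℚ) ^ 2 - 2 * ((r.num * s.den * t.den : ℤ) : ℚ) *
          ((s.num * r.den * t.den : ℤ) : ℚ) - 4 * ((s.num * r.den * t.den : ℤ) : ℚ) *
          ((t.num * r.den * s.den : ℤ) : ℚ) - 2 * ((t.num * r.den * s.den : ℤ) : ℚ) ^ 2 =
          2 * d * ((r.den * s.den * t.den : ℤ) : ℚ) ^ 2 := by
        push_cast
        rw [← hr, ← hs, ← ht]
        linear_combination (r.den * s.den * t.den : ℚ) ^ 2 * h2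
      exact_mod_cast this)
  have h0 := mul_pos (mul_pos r.den_pos s.den_pos) t.den_pos
  have : (r.den * s.den * t.den : ℕ) = 0 := by exact_mod_cast this
  omega

end CubicField

namespace CubicField

/-- Total ramification of 2: powers of 2 can be traded for powers of θ, up to sign and squares of
units. -/
lemma two_eq : (2 : CubicField) = -θ ^ 3 * (1 - θ) ^ 2 := by
  linear_combination (θ ^ 2 + 1) * θ_cube

lemma not_sq_eq_two_mul_sq {y z : ℚ} (hy : y ≠ 0) : z ^ 2 ≠ 2 * y ^ 2 := by
  intro h
  have : IsSquare ((2 : ℕ) : ℚ) := ⟨z / y, by field_simp; push_cast; linarith⟩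
  rw [Rat.isSquare_natCast_iff] at this
  obtain ⟨r, hr⟩ := this
  have : r < 2 := by nlinarith
  interval_cases r <;> omega

lemma norm_θ : Algebra.norm ℚ θ = -2 := by
  have : θ = lin 0 1 0 := by simp [lin]
  rw [this, norm_lin]; norm_num

/-- A unit times a power of `θ` times a square is a square or `τ` times a square as soon as its
norm is a nonzero square. -/
lemma sq_or_τ_mul_sq {δ β : CubicField} {v : (𝓞 CubicField)ˣ} {M : ℕ}
    (h : δ = ((v : 𝓞 CubicField) : CubicField) * θ ^ M * β ^ 2) {q : ℚ} (hq : q ≠ 0)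
    (hn : Algebra.norm ℚ δ = q ^ 2) : ∃ ξ : CubicField, δ = ξ * ξ ∨ δ = (1 - θ) * (ξ * ξ) := by
  have hN : q ^ 2 = Algebra.norm ℚ ((v : 𝓞 CubicField) : CubicField) * (-2) ^ M *
      Algebra.norm ℚ β ^ 2 := by
    rw [← hn, h, map_mul, map_mul, map_pow, map_pow, norm_θ]
  have hb : Algebra.norm ℚ β ≠ 0 := by
    intro hb; rw [hb] at hN; simp at hN; exact hq hN
  have hq2 : 0 < q ^ 2 := by positivity
  -- As θ has norm -2, for even M positivity forces the unit to have norm 1; for odd M the norm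
  -- equation would make 2 or -2 a rational square.
  rcases Nat.even_or_odd' M with ⟨f, rfl | rfl⟩
  · have hv : Algebra.norm ℚ ((v : 𝓞 CubicField) : CubicField) = 1 := by
      refine (norm_unit v).resolve_right fun hv => ?_
      rw [hv, pow_mul] at hN
      have : 0 < ((-2 : ℚ) ^ 2) ^ f * Algebra.norm ℚ β ^ 2 := by positivity
      linarith
    obtain ⟨w, rfl | rfl⟩ := unit_eq_sq_or v hv
    · refine ⟨((w : 𝓞 CubicField) : CubicField) * θ ^ f * β, Or.inl ?_⟩
      rw [h]; push_cast; ring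
    · refine ⟨((w : 𝓞 CubicField) : CubicField) * θ ^ f * β, Or.inr ?_⟩
      rw [h, ← coe_τ]; push_cast; ring
  · exfalso
    have hy : 2 ^ f * Algebra.norm ℚ β ≠ 0 := mul_ne_zero (by positivity) hb
    have e : (-2 : ℚ) ^ (2 * f + 1) = -2 * (2 ^ f) ^ 2 := by
      rw [pow_succ, pow_mul, ← pow_mul 2 f 2, mul_comm f 2, pow_mul]; norm_num; ring
    rw [e] at hN
    rcases norm_unit v with hv | hv
    · rw [hv] at hN
      have : 0 < (2 ^ f * Algebra.norm ℚ β) ^ 2 := by positivity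
      nlinarith
    · rw [hv] at hN
      apply not_sq_eq_two_mul_sq hy (z := q)
      rw [hN]; ring

end CubicField

/-! ### The 2-descent on quadratic twists -/

/-- The binary cubic form `4m³ - 4m²n + n³`. -/
abbrev twistForm (m n : ℤ) : ℤ := 4 * m ^ 3 - 4 * m ^ 2 * n + n ^ 3

lemma twistForm_ne_zero {m n : ℤ} (h : IsCoprime m n) : twistForm m n ≠ 0 := by
  intro h0
  simp only [twistForm] at h0
  obtain ⟨k, rfl⟩ : (2 : ℤ) ∣ n := Int.prime_two.dvd_of_dvd_pow (n := 3)
    ⟨-2 * m ^ 3 + 2 * m ^ 2 * n, by linarith⟩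
  have hm : (2 : ℤ) ∣ m := Int.prime_two.dvd_of_dvd_pow (n := 3)
    ⟨m ^ 2 * k - k ^ 3, by linarith⟩
  exact Int.prime_two.not_isUnit (h.isUnit_of_dvd' hm (dvd_mul_right _ _))

/-- Every rational solution of `d w² = 4x³ - 4x² + 1` is the double of another one. -/
theorem exists_half {d : ℤ} (hd : Odd d) (hdG : ∀ m n, IsCoprime m n → IsCoprime d (twistForm m n))
    {x w : ℚ} (h : d * w ^ 2 = 4 * x ^ 3 - 4 * x ^ 2 + 1) :
    ∃ x' w' : ℚ, d * w' ^ 2 = 4 * x' ^ 3 - 4 * x' ^ 2 + 1 ∧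
      x * (4 * x' ^ 3 - 4 * x' ^ 2 + 1) = x' ^ 4 - 2 * x' + 1 ∧ w' ≠ 0 := by
  have hd0 : d ≠ 0 := by rintro rfl; simp at hd
  obtain ⟨m, n, hn0, hmn, hx⟩ : ∃ m n : ℤ, n ≠ 0 ∧ IsCoprime m n ∧ x * n = m :=
    ⟨x.num, x.den, by exact_mod_cast x.den_ne_zero, Rat.isCoprime_num_den x,
      Rat.mul_den_eq_num x⟩
  have hnQ : (n : ℚ) ≠ 0 := by exact_mod_cast hn0
  have hG0 := twistForm_ne_zero hmn
  have hGQ : ((twistForm m n : ℤ) : ℚ) = n ^ 3 * (d * w ^ 2) := by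
    rw [h]; push_cast [twistForm]; rw [← hx]; ring
  have hw0 : w ≠ 0 := by
    rintro rfl
    apply hG0
    have : ((twistForm m n : ℤ) : ℚ) = 0 := by rw [hGQ]; ring
    exact_mod_cast this
  obtain ⟨W, hW⟩ : IsSquare (d * n * twistForm m n) := by
    rw [← Rat.isSquare_intCast_iff]
    refine ⟨d * n ^ 2 * w, ?_⟩
    rw [Int.cast_mul, hGQ]; push_cast; ring
  -- The odd part G' of the form is coprime to d, to n and to 2, so in the square W² = (d n 2^j) G'
  -- both factors are squares up to sign.
  obtain ⟨j, G', hG', hG'2⟩ : ∃ (j : ℕ) (G' : ℤ), twistForm m n = 2 ^ j * G' ∧ ¬ (2 : ℤ) ∣ G' :=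
    ⟨_, (Int.finiteMultiplicity_iff.mpr ⟨by decide, hG0⟩ :
      FiniteMultiplicity 2 (twistForm m n)).exists_eq_pow_mul_and_not_dvd⟩
  have hG'G : G' ∣ twistForm m n := ⟨2 ^ j, by rw [hG']; ring⟩
  have hcn : IsCoprime n G' := by
    apply isCoprime_of_prime_dvd (fun h => hn0 h.1)
    intro p hp hpn hpG
    have h4 : p ∣ 2 ^ 2 * m ^ 3 := by
      have e : 2 ^ 2 * m ^ 3 = twistForm m n + n * (4 * m ^ 2 - n ^ 2) := by
        simp only [twistForm]; ring
      rw [e]; exact dvd_add (hpG.trans hG'G) (hpn.mul_right _)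
    rcases hp.dvd_or_dvd h4 with h2 | hm
    · have := (hp.associated_of_dvd Int.prime_two (hp.dvd_of_dvd_pow h2)).dvd'
      exact hG'2 (this.trans hpG)
    · exact hp.not_isUnit (hmn.isUnit_of_dvd' (hp.dvd_of_dvd_pow hm) hpn)
  have hcd : IsCoprime d G' := (hdG m n hmn).of_isCoprime_of_dvd_right hG'G
  have hc2 : IsCoprime (2 : ℤ) G' := (Prime.coprime_iff_not_dvd Int.prime_two).mpr hG'2
  have hcop : IsCoprime (d * n * 2 ^ j) G' := (hcd.mul_left hcn).mul_left hc2.pow_left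
  have hprod : (d * n * 2 ^ j) * G' = W ^ 2 := by rw [pow_two, ← hW, hG']; ring
  obtain ⟨k, hk⟩ := Int.sq_of_isCoprime hcop hprod
  obtain ⟨c, hc⟩ := Int.sq_of_isCoprime hcop.symm (by rw [mul_comm]; exact hprod)
  obtain ⟨ε, hε, hkε⟩ : ∃ ε : ℤ, IsUnit ε ∧ d * n * 2 ^ j = ε * k ^ 2 := by
    rcases hk with hk | hk
    · exact ⟨1, isUnit_one, by rw [hk]; ring⟩
    · exact ⟨-1, isUnit_one.neg, by rw [hk]; ring⟩
  obtain ⟨s, hs, hcs⟩ : ∃ s : ℤ, IsUnit s ∧ G' = s * c ^ 2 := by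
    rcases hc with hc | hc
    · exact ⟨1, isUnit_one, by rw [hc]; ring⟩
    · exact ⟨-1, isUnit_one.neg, by rw [hc]; ring⟩
  have hcodd : Odd c := by
    rw [← Int.not_even_iff_odd]
    intro he
    exact hG'2 (hcs ▸ ((even_iff_two_dvd.mp he).trans (dvd_pow_self c two_ne_zero)).mul_left s)
  have hcn' : IsCoprime n c := hcn.of_isCoprime_of_dvd_right ⟨s * c, by rw [hcs]; ring⟩
  -- The norm of 2m - nθ is twice the value of the form.
  obtain ⟨v, e, γ, hα⟩ := CubicField.exists_eq_unit_mul_sq (a := 2 * m) (b := n) (c := c) (s := s)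
    (j := j + 1) hs hcodd hcn' (by
      have : (2 * m) ^ 3 - 2 * (2 * m) ^ 2 * n + 2 * n ^ 3 = 2 * twistForm m n := by
        simp only [twistForm]; ring
      rw [this, hG', hcs]; ring)
  open CubicField in
  -- The element is 2d(2x - θ), the descent image of the point. The factor 2d makes its norm the
  -- square (4d²w)².
  have key : ∃ ξ : CubicField, lin (4 * d * x) (-2 * d) 0 = ξ * ξ ∨
      lin (4 * d * x) (-2 * d) 0 = (1 - θ) * (ξ * ξ) := by
    obtain ⟨σ, hσ⟩ : ∃ σ : (𝓞 CubicField)ˣ, ((σ : 𝓞 CubicField) : CubicField) = ε * (-1) ^ (j + 1) := by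
      rcases Int.isUnit_iff.mp hε with rfl | rfl
      · exact ⟨(-1) ^ (j + 1), by simp⟩
      · exact ⟨-(-1) ^ (j + 1), by simp⟩
    have hnK : (n : CubicField) ≠ 0 := by exact_mod_cast hn0
    have h2K : (2 : CubicField) ^ j ≠ 0 := pow_ne_zero _ two_ne_zero
    have hxK : (x : CubicField) * n = m := by exact_mod_cast congrArg (Rat.cast) hx
    have hαK : 2 * (m : CubicField) - n * θ =
        ((v : 𝓞 CubicField) : CubicField) * θ ^ e * (γ : CubicField) ^ 2 := by
      push_cast at hα
      have := congrArg (algebraMap (𝓞 CubicField) CubicField) hα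
      simp only [map_sub, map_mul, map_pow, map_ofNat, map_intCast, coe_θI] at this
      exact this
    have hkK : (d : CubicField) * n * 2 ^ j = ε * k ^ 2 := by exact_mod_cast congrArg (Int.cast) hkε
    have h2j : (2 : CubicField) ^ (j + 1) =
        (-1) ^ (j + 1) * θ ^ (3 * (j + 1)) * ((1 - θ) ^ (j + 1)) ^ 2 := by
      conv_lhs => rw [two_eq]
      rw [← pow_mul, mul_comm (j + 1) 2, pow_mul, pow_mul, ← mul_pow, ← mul_pow]
      congr 1; ring
    refine sq_or_τ_mul_sq (v := σ * v) (M := 3 * (j + 1) + e)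
      (β := (1 - θ) ^ (j + 1) * k * γ / (2 ^ j * n)) (q := 4 * d ^ 2 * w) ?_ ?_ ?_
    · have e1 : lin (4 * d * x) (-2 * d) 0 = 2 * d * (2 * m - n * θ) / n := by
        rw [eq_div_iff hnK, ← hxK, lin]; push_cast; ring
      have hσv : (((σ * v : (𝓞 CubicField)ˣ) : 𝓞 CubicField) : CubicField) =
          ε * (-1) ^ (j + 1) * ((v : 𝓞 CubicField) : CubicField) := by
        rw [Units.val_mul, ← hσ]; exact map_mul (algebraMap (𝓞 CubicField) CubicField) _ _
      rw [e1, hσv, hαK]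
      have e2 : 2 * (d : CubicField) / n = 2 ^ (j + 1) * (ε * k ^ 2) / (2 ^ j * n) ^ 2 := by
        rw [← hkK]; field_simp; ring
      calc 2 * (d : CubicField) * (((v : 𝓞 CubicField) : CubicField) * θ ^ e * (γ : CubicField) ^ 2) / n
          = (2 * (d : CubicField) / n) *
            (((v : 𝓞 CubicField) : CubicField) * θ ^ e * (γ : CubicField) ^ 2) := by ring
        _ = _ := by rw [e2, h2j, pow_add θ]; ring
    · have : (d : ℚ) ≠ 0 := by exact_mod_cast hd0
      positivity
    · rw [norm_lin]
      linear_combination (-16 * d ^ 3 : ℚ) * h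
  obtain ⟨ξ, hξ⟩ := key
  obtain ⟨r, s, t, rfl⟩ := CubicField.exists_lin ξ
  have hdQ : (d : ℚ) ≠ 0 := by exact_mod_cast hd0
  rcases hξ with hξ | hξ
  -- Trivial class: the point is a double, and v = 2x' returns to the original coordinates.
  · rw [CubicField.lin_mul_self] at hξ
    obtain ⟨h0, h1, h2⟩ := CubicField.lin_injective hξ
    obtain ⟨v, z, hz0, hz1, hz2⟩ := CubicField.duplication_of_sq (e := 2 * d)
      (mul_ne_zero two_ne_zero hdQ) h2.symm (by linarith) h0.symm
    refine ⟨v / 2, z, by linear_combination hz1 / 2, ?_, hz0⟩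
    linear_combination hz2 / 16 - x * hz1 / 2
  -- Class of τ: comparing coefficients gives the system without 2-adic solutions for odd d.
  · rw [CubicField.lin_mul_self] at hξ
    have e3 (A B C : ℚ) : (1 - CubicField.θ) * CubicField.lin A B C =
        CubicField.lin (A + 2 * C) (B - A) (-B - C) := by
      simp only [CubicField.lin]; push_cast
      linear_combination (-C : CubicField) * CubicField.θ_cube
    rw [e3] at hξ
    obtain ⟨h0, h1, h2⟩ := CubicField.lin_injective hξ
    exact (CubicField.no_rational_two_adic hd r s t (by linear_combination h2)
      (by linear_combination h1)).elim

/-! ### Heights and infinite descent -/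

/-- The naive height of a rational number. -/
def naiveHeight (x : ℚ) : ℤ := max |x.num| x.den

/-- Doubling points of `y² - y = x³ - x²`, and of its quadratic twists, increases the height of the
`x`-coordinate. -/
theorem naiveHeight_lt_of_double {x x' : ℚ}
    (h : x * (4 * x' ^ 3 - 4 * x' ^ 2 + 1) = x' ^ 4 - 2 * x' + 1) (hH : 4 ≤ naiveHeight x') :
    naiveHeight x' < naiveHeight x := by
  unfold naiveHeight at *
  have hcop : IsCoprime x'.num (x'.den : ℤ) := Rat.isCoprime_num_den x'
  have hcop₁ : IsCoprime x.num (x.den : ℤ) := Rat.isCoprime_num_den x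
  have hm : x' * x'.den = x'.num := Rat.mul_den_eq_num x'
  have hM : x * x.den = x.num := Rat.mul_den_eq_num x
  have hn : (0 : ℤ) < x'.den := by exact_mod_cast x'.den_pos
  have hN : (0 : ℤ) < x.den := by exact_mod_cast x.den_pos
  generalize x'.num = m at *
  generalize x.num = M at *
  generalize hnn : (x'.den : ℤ) = n at *
  generalize hNN : (x.den : ℤ) = N at *
  have hn' : (x'.den : ℚ) = n := by rw [← hnn]; simp
  have hN' : (x.den : ℚ) = N := by rw [← hNN]; simp
  rw [hn'] at hm
  rw [hN'] at hM
  set A := m ^ 4 - 2 * m * n ^ 3 + n ^ 4 with hA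
  set B := n * (4 * m ^ 3 - 4 * m ^ 2 * n + n ^ 3) with hB
  have hMB : M * B = N * A := by
    have : (M : ℚ) * B = N * A := by
      rw [hA, hB]; push_cast; rw [← hM, ← hm]
      linear_combination (n : ℚ) ^ 4 * N * h
    exact_mod_cast this
  obtain ⟨g, hg⟩ : N ∣ B := hcop₁.symm.dvd_of_dvd_mul_left ⟨A, hMB⟩
  have hgA : A = M * g := mul_left_cancel₀ hN.ne' (by rw [← hMB, hg]; ring)
  -- Cancellation in the duplication formula is bounded: Bézout identities for the quartic and the
  -- cubic express 11m⁷ and 11n⁷ through A and B.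
  have hg11 : g ∣ 11 := by
    have e1 : g ∣ 11 * m ^ 7 := ⟨M * (11 * m ^ 3 - 20 * m ^ 2 * n + 4 * m * n ^ 2 + 6 * n ^ 3) +
      N * (5 * m ^ 3 + 4 * m ^ 2 * n + 8 * m * n ^ 2 - 6 * n ^ 3), by
      have : 11 * m ^ 7 = A * (11 * m ^ 3 - 20 * m ^ 2 * n + 4 * m * n ^ 2 + 6 * n ^ 3) +
        B * (5 * m ^ 3 + 4 * m ^ 2 * n + 8 * m * n ^ 2 - 6 * n ^ 3) := by rw [hA, hB]; ring
      rw [this, hgA, hg]; ring⟩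
    have e2 : g ∣ 11 * n ^ 7 := ⟨M * (48 * m ^ 2 * n - 32 * m * n ^ 2 - 16 * n ^ 3) +
      N * (-12 * m ^ 3 - 4 * m ^ 2 * n + 27 * n ^ 3), by
      have : 11 * n ^ 7 = A * (48 * m ^ 2 * n - 32 * m * n ^ 2 - 16 * n ^ 3) +
        B * (-12 * m ^ 3 - 4 * m ^ 2 * n + 27 * n ^ 3) := by rw [hA, hB]; ring
      rw [this, hgA, hg]; ring⟩
    obtain ⟨a, b, hab⟩ := (hcop.pow : IsCoprime (m ^ 7) (n ^ 7))
    have : (11 : ℤ) = a * (11 * m ^ 7) + b * (11 * n ^ 7) := by linear_combination -11 * hab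
    rw [this]
    exact dvd_add (e1.mul_left _) (e2.mul_left _)
  have hgle : |g| ≤ 11 := by
    have := Int.le_of_dvd (by norm_num) ((abs_dvd g 11).mpr hg11)
    exact this
  -- With at most a factor 11 cancelled, this gives 2H⁴ ≤ 55H' for the heights H, H' of x', x. So H
  -- < H' once 2H³ > 55, and 4 is the least such integer.
  have hmax : 2 * (max |m| n) ^ 4 ≤ 5 * max |A| |B| := by
    have hle_A : A ≤ max |A| |B| := (le_abs_self A).trans (le_max_left _ _)
    have hle_B : B ≤ max |A| |B| := (le_abs_self B).trans (le_max_right _ _)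
    rcases le_total |m| n with hmn | hmn
    · rw [max_eq_right hmn]
      rcases le_or_gt 0 m with h0 | h0
      · have e : 5 * B - 2 * n ^ 4 = n * (20 * (m ^ 3 - m ^ 2 * n) + 3 * n ^ 3) := by
          rw [hB]; ring
        have h1 : 0 ≤ (3 * m - 2 * n) ^ 2 * (3 * m + n) := by positivity
        have h2 : 0 ≤ 20 * (m ^ 3 - m ^ 2 * n) + 3 * n ^ 3 := by
          have : 0 < n ^ 3 := by positivity
          linarith
        have := mul_nonneg hn.le h2
        linarith
      · have : 0 ≤ -m * n ^ 3 := mul_nonneg (by linarith) (by positivity)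
        have : 0 ≤ m ^ 4 := by positivity
        have : 0 < n ^ 4 := by positivity
        linarith
    · rw [max_eq_left hmn]
      rcases le_or_gt 0 m with h0 | h0
      · rw [abs_of_nonneg h0] at hmn ⊢
        rcases le_total (2 * n) m with h2 | h2
        · have h3 : 2 * n * n ^ 2 ≤ m * (m * m) := by
            have : n ^ 2 ≤ m * m := by nlinarith
            gcongr
          have h4 : 4 * (n * n) ≤ m * m := by nlinarith
          have h5 : 0 ≤ (m - 2 * n) * (m * n ^ 2) :=
            mul_nonneg (by linarith) (by positivity)
          have h6 : 0 ≤ (m * m - 4 * (n * n)) * (m * m) :=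
            mul_nonneg (by linarith) (by positivity)
          have : 0 ≤ n ^ 4 := by positivity
          have : 0 ≤ m ^ 4 := by positivity
          linarith
        · have h3 : 0 ≤ (m - n) ^ 2 * (2 * m * (2 * n - m) + (m - n) ^ 2) :=
            mul_nonneg (by positivity) (add_nonneg (mul_nonneg (by positivity) (by linarith))
              (by positivity))
          have : 0 ≤ m ^ 4 := by positivity
          linarith
      · rw [Even.pow_abs (by decide)]
        have : 0 ≤ -m * n ^ 3 := mul_nonneg (by linarith) (by positivity)
        have : 0 ≤ m ^ 4 := by positivity
        have : 0 < n ^ 4 := by positivity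
        linarith
  have hA' : |A| ≤ 11 * max |M| N := by
    rw [hgA, abs_mul, mul_comm]
    exact mul_le_mul hgle (le_max_left _ _) (abs_nonneg _) (by norm_num)
  have hB' : |B| ≤ 11 * max |M| N := by
    rw [hg, abs_mul, mul_comm, abs_of_pos hN]
    exact mul_le_mul hgle (le_max_right _ _) hN.le (by norm_num)
  have h3 : max |A| |B| ≤ 11 * max |M| N := max_le hA' hB'
  generalize max |m| n = H at *
  generalize max |M| N = H' at *
  have h64 : 64 * H ≤ H ^ 4 := by
    have : 64 ≤ H ^ 3 := by
      calc (64 : ℤ) = 4 ^ 3 := by norm_num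
        _ ≤ H ^ 3 := by gcongr
    nlinarith
  omega

/-- All rational solutions of `d w² = 4x³ - 4x² + 1` have small height. -/
theorem naiveHeight_le_of_twist {d : ℤ} (hd : Odd d)
    (hdG : ∀ m n, IsCoprime m n → IsCoprime d (twistForm m n))
    (hsmall : ∀ x w : ℚ, d * w ^ 2 = 4 * x ^ 3 - 4 * x ^ 2 + 1 → naiveHeight x ≤ 3 →
      x = 0 ∨ x = 1) {x w : ℚ} (h : d * w ^ 2 = 4 * x ^ 3 - 4 * x ^ 2 + 1) : x = 0 ∨ x = 1 := by
  obtain ⟨N, hN⟩ : ∃ N : ℕ, naiveHeight x ≤ N := ⟨(naiveHeight x).toNat, Int.self_le_toNat _⟩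
  induction N using Nat.strong_induction_on generalizing x w with
  | _ N ih =>
    by_cases h3 : naiveHeight x ≤ 3
    · exact hsmall x w h h3
    obtain ⟨x', w', h', hx', hw'⟩ := exists_half hd hdG h
    have hlt : naiveHeight x' < naiveHeight x := by
      by_cases h4 : 4 ≤ naiveHeight x'
      · exact naiveHeight_lt_of_double hx' h4
      · omega
    have h0 : 0 ≤ naiveHeight x' := (abs_nonneg _).trans (le_max_left _ _)
    -- Doubling interchanges the abscissas 0 and 1, so a half with one of them gives a point with
    -- the other.
    rcases ih (naiveHeight x').toNat (by omega) h' (Int.self_le_toNat _) with rfl | rfl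
    · right; linarith
    · left; linarith

/-! ### Rational points of the twists by 1, -1, -3 and 5 -/

lemma isSquare_twistForm {d : ℤ} {x w : ℚ} (h : d * w ^ 2 = 4 * x ^ 3 - 4 * x ^ 2 + 1) :
    IsSquare (d * x.den * twistForm x.num x.den) := by
  rw [← Rat.isSquare_intCast_iff]
  refine ⟨d * x.den ^ 2 * w, ?_⟩
  push_cast [twistForm]
  rw [← Rat.mul_den_eq_num x]
  linear_combination (-(x.den : ℚ) ^ 4 * d) * h

lemma small_of_twistForm {d : ℤ} (hd : ∀ m n : ℤ, -3 ≤ m → m ≤ 3 → 1 ≤ n → n ≤ 3 →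
    IsSquare (d * n * twistForm m n) → m = 0 ∨ m = n) {x w : ℚ}
    (h : d * w ^ 2 = 4 * x ^ 3 - 4 * x ^ 2 + 1) (hx : naiveHeight x ≤ 3) : x = 0 ∨ x = 1 := by
  have h1 : |x.num| ≤ 3 := (le_max_left _ _).trans hx
  have h2 : (x.den : ℤ) ≤ 3 := (le_max_right _ _).trans hx
  have h3 := x.den_pos
  rcases hd x.num x.den (abs_le.mp h1).1 (abs_le.mp h1).2 (by omega) h2
    (isSquare_twistForm h) with h0 | h0
  · left; exact Rat.num_eq_zero.mp h0
  · right
    rw [← Rat.num_div_den x, h0]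
    have : (x.den : ℚ) ≠ 0 := by exact_mod_cast x.den_ne_zero
    simp [this]

/-- If the form has no nontrivial zero modulo p, then p can divide a value only by dividing both
arguments. -/
lemma isCoprime_twistForm_of_prime {p : ℕ} (hpr : p.Prime) (hp : ∀ m n : ZMod p,
    4 * m ^ 3 - 4 * m ^ 2 * n + n ^ 3 = 0 → m = 0 ∧ n = 0) {m n : ℤ} (h : IsCoprime m n) :
    IsCoprime (p : ℤ) (twistForm m n) := by
  have hpp : Prime (p : ℤ) := Nat.prime_iff_prime_int.mp hpr
  rw [Prime.coprime_iff_not_dvd hpp]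
  intro hd
  have h0 := (ZMod.intCast_zmod_eq_zero_iff_dvd _ p).mpr hd
  push_cast [twistForm] at h0
  obtain ⟨h1, h2⟩ := hp _ _ h0
  rw [ZMod.intCast_zmod_eq_zero_iff_dvd] at h1 h2
  exact hpp.not_isUnit (h.isUnit_of_dvd' h1 h2)

theorem twist_one {x w : ℚ} (h : w ^ 2 = 4 * x ^ 3 - 4 * x ^ 2 + 1) : x = 0 ∨ x = 1 := by
  refine naiveHeight_le_of_twist (d := 1) odd_one (fun _ _ _ => isCoprime_one_left)
    (fun x w => small_of_twistForm ?_) (w := w) (by push_cast; linarith)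
  intro m n h1 h2 h3 h4 hs
  interval_cases m <;> interval_cases n <;>
    first | (norm_num; done) | norm_num [twistForm] at hs

/-- The cubic takes the value 1 at 0 and 1, and d w² = 1 makes d a square. -/
lemma twist_not_zero_one {d : ℤ} (hd : ¬ IsSquare d) {x w : ℚ}
    (h : d * w ^ 2 = 4 * x ^ 3 - 4 * x ^ 2 + 1) : ¬ (x = 0 ∨ x = 1) := by
  intro h01
  have h1 : (d : ℚ) * w ^ 2 = 1 := by rw [h]; rcases h01 with rfl | rfl <;> norm_num
  apply hd
  rw [← Rat.isSquare_intCast_iff]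
  have hw : w ≠ 0 := by rintro rfl; norm_num at h1
  exact ⟨1 / w, by field_simp; linarith⟩

theorem twist_neg_one (x w : ℚ) : -1 * w ^ 2 ≠ 4 * x ^ 3 - 4 * x ^ 2 + 1 := by
  intro h
  refine twist_not_zero_one (d := -1) (by decide) (w := w) (by push_cast; exact h)
    (naiveHeight_le_of_twist (d := -1) (by decide) (fun _ _ _ => isCoprime_one_left.neg_left)
    (fun x w => small_of_twistForm ?_) (w := w) (by push_cast; exact h))
  intro m n h1 h2 h3 h4 hs
  interval_cases m <;> interval_cases n <;>
    first | (norm_num; done) | norm_num [twistForm] at hs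

theorem twist_neg_three (x w : ℚ) : -3 * w ^ 2 ≠ 4 * x ^ 3 - 4 * x ^ 2 + 1 := by
  intro h
  refine twist_not_zero_one (d := -3) (by decide) (w := w) (by push_cast; exact h)
    (naiveHeight_le_of_twist (d := -3) (by decide)
    (fun _ _ h => (isCoprime_twistForm_of_prime Nat.prime_three (by decide) h).neg_left)
    (fun x w => small_of_twistForm ?_) (w := w) (by push_cast; exact h))
  intro m n h1 h2 h3 h4 hs
  interval_cases m <;> interval_cases n <;>
    first | (norm_num; done) | norm_num [twistForm] at hs

theorem twist_five (x w : ℚ) : 5 * w ^ 2 ≠ 4 * x ^ 3 - 4 * x ^ 2 + 1 := by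
  intro h
  refine twist_not_zero_one (d := 5) (by norm_num) (w := w) (by push_cast; exact h)
    (naiveHeight_le_of_twist (d := 5) (by decide)
    (fun _ _ h => isCoprime_twistForm_of_prime Nat.prime_five (by decide) h)
    (fun x w => small_of_twistForm ?_) (w := w) (by push_cast; exact h))
  intro m n h1 h2 h3 h4 hs
  interval_cases m <;> interval_cases n <;>
    first | (norm_num; done) | norm_num [twistForm] at hs

/-! ### Points of X₁(11) over ℚ(√d) -/

section

variable {d : ℚ} [Fact (∀ r : ℚ, r ^ 2 ≠ d + 0 * r)]

/-- If the twist of `y² - y = x³ - x²` by `d` has no affine rational point, then the points over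
`ℚ(√d)` are those over `ℚ`. -/
theorem modularX1_11_points (hd : ∀ x w : ℚ, d * w ^ 2 ≠ 4 * x ^ 3 - 4 * x ^ 2 + 1)
    {x y : QuadField d} (h : y ^ 2 - y = x ^ 3 - x ^ 2) : (x = 0 ∨ x = 1) ∧ (y = 0 ∨ y = 1) := by
  obtain ⟨p, q⟩ := x
  obtain ⟨r, s⟩ := y
  have hd0 : d ≠ 0 := by
    rintro rfl
    exact (Fact.out : ∀ r : ℚ, r ^ 2 ≠ 0 + 0 * r) 0 (by norm_num)
  have h1 := congrArg QuadraticAlgebra.re h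
  have h2 := congrArg QuadraticAlgebra.im h
  simp only [pow_succ, pow_zero, one_mul, QuadraticAlgebra.mk_mul_mk, QuadraticAlgebra.mk_sub_mk]
    at h1 h2
  have hq : q = 0 := by
    by_contra hq
    -- The line through P and -P̄ has slope l√d, so P - P̄ has rational abscissa d l² + 1 - 2p and
    -- yields a rational point of the twist.
    have hl : (2 * r - 1) / (2 * q * d) * (2 * q * d) = 2 * r - 1 :=
      div_mul_cancel₀ _ (by positivity)
    generalize (2 * r - 1) / (2 * q * d) = l at hl
    apply hd (d * l ^ 2 + 1 - 2 * p) (2 * (l * (d * l ^ 2 + 1 - 2 * p - p) + s))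
    have h3 : 2 * d * l * s = 3 * p ^ 2 + d * q ^ 2 - 2 * p :=
      mul_left_cancel₀ hq (by linear_combination h2 + s * hl)
    obtain rfl : r = (1 + 2 * q * d * l) / 2 := by linarith
    linear_combination 4 * h1 + 4 * (d * l ^ 2 + 1 - 2 * p - p) * h3
  subst hq
  -- With a rational abscissa P̄ = ±P: either y is rational, or y = 1/2 + s√d and P itself comes
  -- from the twist.
  have hrs : s * (2 * r - 1) = 0 := by linarith
  have hs : s = 0 := by
    rcases mul_eq_zero.mp hrs with h0 | h0
    · exact h0
    · exfalso
      have hr : r = 1 / 2 := by linarith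
      subst hr
      exact hd p (2 * s) (by linarith)
  subst hs
  have hx : p = 0 ∨ p = 1 := twist_one (w := 2 * r - 1) (by linarith)
  have hy : r * (r - 1) = 0 := by
    rcases hx with rfl | rfl <;> linarith
  refine ⟨?_, ?_⟩
  · rcases hx with rfl | rfl
    · left; rfl
    · right; rfl
  · rcases mul_eq_zero.mp hy with h0 | h0
    · left; rw [h0]; rfl
    · right; rw [sub_eq_zero.mp h0]; rfl

end

section

variable {K : Type*} [Field K]

lemma modularX1_11_nonsingular {x y : K} (hx : x = 0 ∨ x = 1) (hy : y = 0 ∨ y = 1) :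
    (modularX1_11 K).toAffine.Nonsingular x y := by
  rw [WeierstrassCurve.Affine.nonsingular_iff, WeierstrassCurve.Affine.equation_iff]
  rcases hx with rfl | rfl <;> rcases hy with rfl | rfl <;> simp [modularX1_11]

/-- Together with infinity these are exactly five points, so the group is finite of prime order.
Those with x = 1 are cusps because c = b = 0 there. -/
theorem rankZeroCuspidalTorsion11_of_points [DecidableEq K]
    (h : ∀ x y : K, y ^ 2 - y = x ^ 3 - x ^ 2 → (x = 0 ∨ x = 1) ∧ (y = 0 ∨ y = 1)) :
    RankZeroCuspidalTorsion11 K := by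
  have hcoord (x y : K) (hxy : (modularX1_11 K).toAffine.Nonsingular x y) :
      (x = 0 ∨ x = 1) ∧ (y = 0 ∨ y = 1) := by
    have := (WeierstrassCurve.Affine.equation_iff ..).mp hxy.1
    simp only [modularX1_11] at this
    exact h x y (by linear_combination this)
  let f : Option (Bool × Bool) → (modularX1_11 K).toAffine.Point
    | none => 0
    | some (a, b) => .some (if a then 1 else 0) (if b then 1 else 0)
        (modularX1_11_nonsingular (by cases a <;> simp) (by cases b <;> simp))
  have hf : Function.Bijective f := by
    constructor
    · rintro (_ | ⟨a, b⟩) (_ | ⟨a', b'⟩) hab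
      · rfl
      · exact absurd hab.symm (WeierstrassCurve.Affine.Point.some_ne_zero _)
      · exact absurd hab (WeierstrassCurve.Affine.Point.some_ne_zero _)
      · simp only [f, WeierstrassCurve.Affine.Point.some.injEq] at hab
        revert hab
        cases a <;> cases b <;> cases a' <;> cases b' <;> simp
    · rintro (_ | ⟨x, y, hxy⟩)
      · exact ⟨none, rfl⟩
      · obtain ⟨hx, hy⟩ := hcoord x y hxy
        refine ⟨some (decide (x = 1), decide (y = 1)), ?_⟩
        rcases hx with rfl | rfl <;> rcases hy with rfl | rfl <;> simp [f]
  have hcard : Nat.card (modularX1_11 K).toAffine.Point = 5 := by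
    rw [← Nat.card_eq_of_bijective f hf]
    simp
  have hfin : Finite (modularX1_11 K).toAffine.Point := Nat.finite_of_card_ne_zero (by rw [hcard]; decide)
  have htors : AddCommGroup.torsion (modularX1_11 K).toAffine.Point = ⊤ := by
    rw [AddSubgroup.eq_top_iff']
    exact fun P => isOfFinAddOrder_of_finite P
  refine ⟨?_, ?_, ?_⟩
  · rw [rank_eq_zero_iff]
    intro P
    refine ⟨5, by norm_num, ?_⟩
    have := card_nsmul_eq_zero' (x := P)
    rw [hcard] at this
    exact_mod_cast this
  · rw [htors]
    have : Fact (Nat.Prime 5) := ⟨Nat.prime_five⟩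
    have hc := isAddCyclic_of_prime_card hcard
    have e := zmodAddCyclicAddEquiv hc
    rw [hcard] at e
    exact ⟨AddSubgroup.topEquiv.trans e.symm⟩
  · rintro (_ | ⟨x, y, hxy⟩) -
    · trivial
    · obtain ⟨hx, hy⟩ := hcoord x y hxy
      rcases hx with rfl | rfl
      · exact Or.inl rfl
      · right
        rcases hy with rfl | rfl <;>
          simp [universalCurve11, tateNormalForm, WeierstrassCurve.Δ, WeierstrassCurve.b₂,
            WeierstrassCurve.b₄, WeierstrassCurve.b₆, WeierstrassCurve.b₈]

end

theorem points_neg_one {x y : QuadField (-1)} (h : y ^ 2 - y = x ^ 3 - x ^ 2) :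
    (x = 0 ∨ x = 1) ∧ (y = 0 ∨ y = 1) := modularX1_11_points twist_neg_one h

theorem points_neg_three {x y : QuadField (-3)} (h : y ^ 2 - y = x ^ 3 - x ^ 2) :
    (x = 0 ∨ x = 1) ∧ (y = 0 ∨ y = 1) := modularX1_11_points twist_neg_three h

theorem points_five {x y : QuadField 5} (h : y ^ 2 - y = x ^ 3 - x ^ 2) :
    (x = 0 ∨ x = 1) ∧ (y = 0 ∨ y = 1) := modularX1_11_points twist_five h

theorem rankZero_neg_one : RankZeroCuspidalTorsion11 (QuadField (-1)) :=
  rankZeroCuspidalTorsion11_of_points fun _ _ => points_neg_one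

theorem rankZero_neg_three : RankZeroCuspidalTorsion11 (QuadField (-3)) :=
  rankZeroCuspidalTorsion11_of_points fun _ _ => points_neg_three

theorem rankZero_five : RankZeroCuspidalTorsion11 (QuadField 5) :=
  rankZeroCuspidalTorsion11_of_points fun _ _ => points_five

/-! ### Changes of variables as group homomorphisms, explicit addition -/

namespace WeierstrassCurve

namespace VariableChange

variable {F : Type*} [Field F] (C : VariableChange F)

/-- The `X`-coordinate of a point after a change of variables. -/
def mapX (x : F) : F := (C.u⁻¹ : Fˣ) ^ 2 * (x - C.r)

/-- The `Y`-coordinate of a point after a change of variables. -/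
def mapY (x y : F) : F := (C.u⁻¹ : Fˣ) ^ 3 * (y - C.s * (x - C.r) - C.t)

lemma inv_u_ne_zero : ((C.u⁻¹ : Fˣ) : F) ≠ 0 := C.u⁻¹.ne_zero

lemma mapX_inj {x x' : F} : C.mapX x = C.mapX x' ↔ x = x' := by
  simp [mapX]

lemma mapY_inj {x y y' : F} : C.mapY x y = C.mapY x y' ↔ y = y' := by
  simp [mapY]

variable (W : Affine F)

lemma mapY_negY (x y : F) :
    C.mapY x (W.negY x y) = (C • W).toAffine.negY (C.mapX x) (C.mapY x y) := by
  simp only [mapY, mapX, Affine.negY, variableChange_def]; ring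

lemma equation_map {x y : F} (h : W.Equation x y) :
    (C • W).toAffine.Equation (C.mapX x) (C.mapY x y) := by
  rw [Affine.equation_iff'] at h ⊢
  simp only [mapY, mapX, variableChange_def]
  linear_combination ((C.u⁻¹ : Fˣ) : F) ^ 6 * h

lemma nonsingular_map {x y : F} (h : W.Nonsingular x y) :
    (C • W).toAffine.Nonsingular (C.mapX x) (C.mapY x y) := by
  refine (Affine.nonsingular_iff' ..).mpr ⟨C.equation_map W h.1, ?_⟩
  have hv := C.inv_u_ne_zero
  by_contra! hcon
  obtain ⟨h1, h2⟩ := hcon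
  simp only [mapY, mapX, variableChange_def] at h1 h2
  have h3 : 2 * y + W.a₁ * x + W.a₃ = 0 := by
    refine (mul_eq_zero.mp ?_).resolve_left (pow_ne_zero 3 hv)
    linear_combination h2
  have h4 : W.a₁ * y - (3 * x ^ 2 + 2 * W.a₂ * x + W.a₄) = 0 := by
    refine (mul_eq_zero.mp ?_).resolve_left (pow_ne_zero 4 hv)
    linear_combination h1 - C.s * ((C.u⁻¹ : Fˣ) : F) ^ 4 * h3
  rcases ((Affine.nonsingular_iff' ..).mp h).2 with h | h
  · exact h h4
  · exact h h3

variable [DecidableEq F]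

lemma slope_map {x₁ x₂ y₁ y₂ : F} (hxy : ¬(x₁ = x₂ ∧ y₁ = W.negY x₂ y₂)) (h₁ : W.Equation x₁ y₁)
    (h₂ : W.Equation x₂ y₂) :
    (C • W).toAffine.slope (C.mapX x₁) (C.mapX x₂) (C.mapY x₁ y₁) (C.mapY x₂ y₂) =
      (C.u⁻¹ : Fˣ) * (W.slope x₁ x₂ y₁ y₂ - C.s) := by
  have hv := C.inv_u_ne_zero
  by_cases hx : x₁ = x₂
  · subst hx
    have hy : y₁ ≠ W.negY x₁ y₂ := fun h => hxy ⟨rfl, h⟩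
    have hyy : y₁ = y₂ := Affine.Y_eq_of_Y_ne h₁ h₂ rfl hy
    subst hyy
    have hy' : C.mapY x₁ y₁ ≠ (C • W).toAffine.negY (C.mapX x₁) (C.mapY x₁ y₁) := by
      rwa [← mapY_negY, Ne, mapY_inj]
    rw [Affine.slope_of_Y_ne rfl hy, Affine.slope_of_Y_ne rfl hy', ← mapY_negY]
    have h1 : y₁ - W.negY x₁ y₁ ≠ 0 := sub_ne_zero.mpr hy
    have h2 : C.mapY x₁ y₁ - C.mapY x₁ (W.negY x₁ y₁) =
        ((C.u⁻¹ : Fˣ) : F) ^ 3 * (y₁ - W.negY x₁ y₁) := by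
      simp only [mapY]; ring
    rw [h2, div_eq_iff (mul_ne_zero (pow_ne_zero 3 hv) h1)]
    have h3 := div_mul_cancel₀ (3 * x₁ ^ 2 + 2 * W.a₂ * x₁ + W.a₄ - W.a₁ * y₁) h1
    generalize (3 * x₁ ^ 2 + 2 * W.a₂ * x₁ + W.a₄ - W.a₁ * y₁) / (y₁ - W.negY x₁ y₁) = l at h3
    simp only [mapY, mapX, variableChange_def, Affine.negY] at h3 ⊢
    linear_combination -((C.u⁻¹ : Fˣ) : F) ^ 4 * h3
  · rw [Affine.slope_of_X_ne hx, Affine.slope_of_X_ne (by rwa [Ne, mapX_inj])]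
    have h1 : x₁ - x₂ ≠ 0 := sub_ne_zero.mpr hx
    have h2 : C.mapX x₁ - C.mapX x₂ = ((C.u⁻¹ : Fˣ) : F) ^ 2 * (x₁ - x₂) := by
      simp only [mapX]; ring
    rw [h2, div_eq_iff (mul_ne_zero (pow_ne_zero 2 hv) h1)]
    have h3 := div_mul_cancel₀ (y₁ - y₂) h1
    generalize (y₁ - y₂) / (x₁ - x₂) = l at h3
    simp only [mapY]
    linear_combination -((C.u⁻¹ : Fˣ) : F) ^ 3 * h3

/-- The group homomorphism on points induced by a change of variables. -/
def mapPoint : W.Point →+ (C • W).toAffine.Point where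
  toFun P := match P with
    | .zero => 0
    | .some _ _ h => .some _ _ (C.nonsingular_map W h)
  map_zero' := rfl
  map_add' := by
    rintro (_ | ⟨x₁, y₁, h₁⟩) (_ | ⟨x₂, y₂, h₂⟩)
    any_goals rfl
    by_cases hxy : x₁ = x₂ ∧ y₁ = W.negY x₂ y₂
    · rw [Affine.Point.add_of_Y_eq hxy.1 hxy.2,
        Affine.Point.add_of_Y_eq (by rw [hxy.1]) (by rw [hxy.2, hxy.1, mapY_negY])]
    · have hxy' : ¬(C.mapX x₁ = C.mapX x₂ ∧
          C.mapY x₁ y₁ = (C • W).toAffine.negY (C.mapX x₂) (C.mapY x₂ y₂)) := by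
        rintro ⟨ha, hb⟩
        rw [mapX_inj] at ha
        subst ha
        rw [← mapY_negY, mapY_inj] at hb
        exact hxy ⟨rfl, hb⟩
      rw [Affine.Point.add_some hxy, Affine.Point.add_some hxy']
      simp only [Affine.Point.some.injEq]
      rw [C.slope_map W hxy h₁.1 h₂.1]
      constructor
      · simp only [mapX, Affine.addX, variableChange_def]; ring
      · simp only [mapX, mapY, Affine.addY, Affine.negAddY, Affine.negY, Affine.addX,
          variableChange_def]; ring

lemma mapPoint_some {x y : F} (h : W.Nonsingular x y) :
    C.mapPoint W (.some x y h) = .some _ _ (C.nonsingular_map W h) := rfl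

lemma mapPoint_injective : Function.Injective (C.mapPoint W) := by
  rw [injective_iff_map_eq_zero]
  rintro (_ | ⟨x, y, h⟩) h0
  · rfl
  · exact absurd h0 (Affine.Point.some_ne_zero _)

end VariableChange

/-- The slope of a line through two points, from a chord or tangent equation. -/
lemma Affine.slope_eq_of_mul_eq {F : Type*} [Field F] [DecidableEq F] {W : Affine F}
    {x₁ y₁ x₂ y₂ ℓ : F} (hℓ : x₁ ≠ x₂ ∧ ℓ * (x₁ - x₂) = y₁ - y₂ ∨ x₁ = x₂ ∧ y₁ = y₂ ∧
      2 * y₁ + W.a₁ * x₁ + W.a₃ ≠ 0 ∧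
      ℓ * (2 * y₁ + W.a₁ * x₁ + W.a₃) = 3 * x₁ ^ 2 + 2 * W.a₂ * x₁ + W.a₄ - W.a₁ * y₁) :
    ¬(x₁ = x₂ ∧ y₁ = W.negY x₂ y₂) ∧ W.slope x₁ x₂ y₁ y₂ = ℓ := by
  rcases hℓ with ⟨hne, hl⟩ | ⟨rfl, rfl, hne, hl⟩
  · refine ⟨fun h => hne h.1, ?_⟩
    rw [slope_of_X_ne hne, div_eq_iff (sub_ne_zero.mpr hne), hl]
  · have hny : y₁ ≠ W.negY x₁ y₁ := fun h => hne (by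
      rw [negY] at h; linear_combination h)
    refine ⟨fun h => hny h.2, ?_⟩
    rw [slope_of_Y_ne rfl hny, div_eq_iff (sub_ne_zero.mpr hny), ← hl, negY]
    ring

/-- Addition of two points with a known chord or tangent slope. -/
lemma Affine.Point.exists_add_eq_some {F : Type*} [Field F] [DecidableEq F] {W : Affine F}
    {x₁ y₁ x₂ y₂ x₃ y₃ ℓ : F} (h₁ : W.Nonsingular x₁ y₁) (h₂ : W.Nonsingular x₂ y₂)
    (hℓ : x₁ ≠ x₂ ∧ ℓ * (x₁ - x₂) = y₁ - y₂ ∨ x₁ = x₂ ∧ y₁ = y₂ ∧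
      2 * y₁ + W.a₁ * x₁ + W.a₃ ≠ 0 ∧
      ℓ * (2 * y₁ + W.a₁ * x₁ + W.a₃) = 3 * x₁ ^ 2 + 2 * W.a₂ * x₁ + W.a₄ - W.a₁ * y₁)
    (hx : x₃ = ℓ ^ 2 + W.a₁ * ℓ - W.a₂ - x₁ - x₂)
    (hy : y₃ = -(ℓ * (x₃ - x₁) + y₁) - W.a₁ * x₃ - W.a₃) :
    ∃ h₃ : W.Nonsingular x₃ y₃, some x₁ y₁ h₁ + some x₂ y₂ h₂ = some x₃ y₃ h₃ := by
  have hs := slope_eq_of_mul_eq hℓ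
  have h₃ := nonsingular_add h₁ h₂ hs.1
  have e : W.addX x₁ x₂ ℓ = x₃ ∧ W.addY x₁ x₂ y₁ ℓ = y₃ := by
    simp only [addX, addY, negAddY, negY]
    rw [hy, hx]
    exact ⟨rfl, rfl⟩
  rw [hs.2, e.1, e.2] at h₃
  refine ⟨h₃, ?_⟩
  rw [add_some hs.1]
  simp only [hs.2, e]

/-- Addition of two points with a known chord or tangent slope. -/
lemma Affine.Point.add_eq_some {F : Type*} [Field F] [DecidableEq F] {W : Affine F}
    {x₁ y₁ x₂ y₂ x₃ y₃ ℓ : F} {h₁ : W.Nonsingular x₁ y₁} {h₂ : W.Nonsingular x₂ y₂}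
    (h₃ : W.Nonsingular x₃ y₃)
    (hℓ : x₁ ≠ x₂ ∧ ℓ * (x₁ - x₂) = y₁ - y₂ ∨ x₁ = x₂ ∧ y₁ = y₂ ∧
      2 * y₁ + W.a₁ * x₁ + W.a₃ ≠ 0 ∧
      ℓ * (2 * y₁ + W.a₁ * x₁ + W.a₃) = 3 * x₁ ^ 2 + 2 * W.a₂ * x₁ + W.a₄ - W.a₁ * y₁)
    (hx : x₃ = ℓ ^ 2 + W.a₁ * ℓ - W.a₂ - x₁ - x₂)
    (hy : y₃ = -(ℓ * (x₃ - x₁) + y₁) - W.a₁ * x₃ - W.a₃) :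
    some x₁ y₁ h₁ + some x₂ y₂ h₂ = some x₃ y₃ h₃ :=
  (exists_add_eq_some h₁ h₂ hℓ hx hy).2

end WeierstrassCurve

open WeierstrassCurve

lemma nsmul_ne_zero_of_addOrderOf {A : Type*} [AddGroup A] {P : A} {n k : ℕ} (h : addOrderOf P = n)
    (h0 : 0 < k) (hk : k < n) : k • P ≠ 0 := by
  intro hP
  have := Nat.le_of_dvd h0 (addOrderOf_dvd_of_nsmul_eq_zero hP)
  omega

/-! ### From a point of order 11 to a point of X₁(11) -/

section

variable {K : Type*} [Field K] [DecidableEq K]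

/-- If the point `(0, 0)` of a curve in Tate's normal form has order `11`, then the curve comes
from a point of `X₁(11)`. -/
theorem exists_point_of_tateNormalForm {W : Affine K} [W.IsElliptic] {b c : K} (ha₁ : W.a₁ = 1 - c)
    (ha₂ : W.a₂ = -b) (ha₃ : W.a₃ = -b) (ha₄ : W.a₄ = 0) (ha₆ : W.a₆ = 0) (hb : b ≠ 0)
    (h0 : W.Nonsingular 0 0) (hord : addOrderOf (Affine.Point.some 0 0 h0) = 11) :
    ∃ x y : K, y ^ 2 - y = x ^ 3 - x ^ 2 ∧ x ≠ 0 ∧ x ≠ 1 := by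
  have ns {x y : K} (h : y ^ 2 + (1 - c) * x * y - b * y = x ^ 3 - b * x ^ 2) :
      W.Nonsingular x y := by
    rw [← Affine.equation_iff_nonsingular, Affine.equation_iff, ha₁, ha₂, ha₃, ha₄, ha₆]
    linear_combination h
  generalize hP : Affine.Point.some 0 0 h0 = P at hord
  have h1 : 1 • P = .some _ _ h0 := by rw [one_nsmul, hP]
  have hne {k : ℕ} (h1 : 0 < k) (h2 : k < 11) : k • P ≠ 0 := nsmul_ne_zero_of_addOrderOf hord h1 h2
  have h11 : 11 • P = 0 := hord ▸ addOrderOf_nsmul_eq_zero P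
  have n2 : W.Nonsingular b (b * c) := ns (by ring)
  have h2 : P + P = .some _ _ n2 := by
    rw [← hP]
    exact Affine.Point.add_eq_some (ℓ := 0) n2
      (Or.inr ⟨rfl, rfl, by simpa [ha₁, ha₃] using hb, by simp [ha₄]⟩)
      (by rw [ha₁, ha₂]; ring) (by rw [ha₁, ha₃]; ring)
  have n3 : W.Nonsingular c (b - c) := ns (by ring)
  have h3 : Affine.Point.some _ _ n2 + P = .some _ _ n3 := by
    rw [← hP]
    exact Affine.Point.add_eq_some (ℓ := c) n3 (Or.inl ⟨hb, by ring⟩)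
      (by rw [ha₁, ha₂]; ring) (by rw [ha₁, ha₃]; ring)
  have h3' : 3 • P = .some _ _ n3 := by rw [← h3, ← h2]; abel
  -- Equal abscissas of kP and lP would give (l - k)P = 0 or (k + l)P = 0. The inequalities so
  -- obtained justify each division below.
  have hsame {x y : K} (n : W.Nonsingular x y) {k l : ℕ} (hk : 0 < k) (hl : 0 < l) (hkl : k < l)
      (hkl' : k + l < 11) {x' y' : K} {n' : W.Nonsingular x' y'} (e1 : k • P = .some _ _ n)
      (e2 : l • P = .some _ _ n') : x ≠ x' := by
    intro hx
    rcases (Affine.Point.X_eq_iff (h₁ := n) (h₂ := n')).mp hx with h | h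
    · rw [← e1, ← e2] at h
      apply hne (k := l - k) (by omega) (by omega)
      rw [sub_nsmul _ hkl.le, ← h]; abel
    · rw [← e1, ← e2] at h
      apply hne (k := k + l) (by omega) (by omega)
      rw [add_nsmul, h]; abel
  have hc : c ≠ 0 := (hsame h0 (k := 1) (l := 3) (by norm_num) (by norm_num) (by norm_num)
    (by norm_num) h1 h3').symm
  -- In terms of d = b/c the coordinates of 4P become polynomials.
  obtain ⟨d, rfl⟩ : ∃ d, b = c * d := ⟨b / c, by field_simp⟩
  have n4 : W.Nonsingular (d * (d - 1)) (d ^ 2 * (c - d + 1)) := ns (by ring)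
  have h4 : Affine.Point.some _ _ n3 + P = .some _ _ n4 := by
    rw [← hP]
    exact Affine.Point.add_eq_some (ℓ := d - 1) n4 (Or.inl ⟨hc, by ring⟩)
      (by rw [ha₁, ha₂]; ring) (by rw [ha₁, ha₃]; ring)
  have h4' : 4 • P = .some _ _ n4 := by rw [← h4, ← h3']; abel
  have hd : d * (d - 1) ≠ 0 := (hsame h0 (k := 1) (l := 4) (by norm_num) (by norm_num) (by norm_num)
    (by norm_num) h1 h4').symm
  have h34 : c ≠ d * (d - 1) := hsame n3 (k := 3) (l := 4) (by norm_num) (by norm_num) (by norm_num)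
    (by norm_num) h3' h4'
  -- The condition 11P = 0 in the form 3P + 4P = -4P; its abscissas give the plane equation `hf`
  -- between c and d.
  have h7 : Affine.Point.some _ _ n3 + .some _ _ n4 = -.some _ _ n4 := by
    rw [← h3', ← h4', ← add_nsmul, eq_neg_iff_add_eq_zero, ← add_nsmul]
    exact h11
  rw [Affine.Point.add_of_X_ne h34, Affine.Point.neg_some, Affine.Point.some.injEq] at h7
  have hx := h7.1
  rw [Affine.slope_of_X_ne h34, Affine.addX] at hx
  have hM : c - d * (d - 1) ≠ 0 := sub_ne_zero.mpr h34
  have hm := div_mul_cancel₀ (c * d - c - d ^ 2 * (c - d + 1)) hM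
  generalize (c * d - c - d ^ 2 * (c - d + 1)) / (c - d * (d - 1)) = m at hm hx
  rw [ha₁, ha₂] at hx
  obtain ⟨hd0, hd1⟩ := mul_ne_zero_iff.mp hd
  have hf : d * (c + 1 - d) ^ 3 = (d - 1) ^ 3 * (d ^ 2 - d - c) := by
    apply mul_left_cancel₀ hd0
    linear_combination (c - d * (d - 1)) ^ 2 * hx -
      (c * d - c - d ^ 2 * (c - d + 1) + m * (c - d * (d - 1)) + (1 - c) * (c - d * (d - 1))) * hm
  have he : c + 1 - d ≠ 0 := by
    intro he
    have hc' : c = d - 1 := by linear_combination he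
    rw [he, hc'] at hf
    have : (d - 1) ^ 5 = 0 := by linear_combination -hf
    exact hd1 (pow_eq_zero_iff (by norm_num) |>.mp this)
  -- Inverse of the modular parametrization: b = (1 - y)c gives y = 1 - d, and c = y(y - x)/x gives
  -- x = y²/(c + y).
  refine ⟨(1 - d) ^ 2 / (c + 1 - d), 1 - d, ?_, ?_, ?_⟩
  · field_simp
    linear_combination (d - 1) * hf
  · have : 1 - d ≠ 0 := fun h => hd1 (by linear_combination -h)
    positivity
  · intro h1
    rw [div_eq_one_iff_eq he] at h1
    have : d * (c + 1 - d) ^ 3 = 0 := by rw [hf]; linear_combination (d - 1) ^ 3 * h1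
    exact (mul_ne_zero hd0 (pow_ne_zero 3 he)) this

lemma exists_point_of_origin {W : Affine K} [W.IsElliptic] (ha₄ : W.a₄ = 0) (ha₆ : W.a₆ = 0)
    (ha₃ : W.a₃ ≠ 0) (hn : W.Nonsingular 0 0)
    (hord : addOrderOf (Affine.Point.some 0 0 hn) = 11) :
    ∃ x y : K, y ^ 2 - y = x ^ 3 - x ^ 2 ∧ x ≠ 0 ∧ x ≠ 1 := by
  -- The tangent at the origin is Y = 0; if a₂ vanished, it would meet the curve there to order
  -- three and 3P would be 0.
  have ha₂ : W.a₂ ≠ 0 := by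
    intro h2
    apply nsmul_ne_zero_of_addOrderOf hord (k := 3) (by norm_num) (by norm_num)
    have hnn : W.Nonsingular 0 (-W.a₃) := by
      have := (Affine.nonsingular_neg (W' := W) 0 0).mpr hn
      simpa [Affine.negY] using this
    have : Affine.Point.some 0 0 hn + .some 0 0 hn = .some 0 (-W.a₃) hnn :=
      Affine.Point.add_eq_some (ℓ := 0) hnn (Or.inr ⟨rfl, rfl, by simpa using ha₃, by simp [ha₄]⟩)
        (by simp [h2]) (by simp)
    rw [succ_nsmul, two_nsmul, this]
    exact Affine.Point.add_of_Y_eq rfl (by simp [Affine.negY])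
  -- This scaling makes the new a₂ and a₃ equal, as Tate's form requires.
  let u : Kˣ := Units.mk0 (W.a₃ / W.a₂) (div_ne_zero ha₃ ha₂)
  let C : VariableChange K := ⟨u, 0, 0, 0⟩
  have hord' := (addOrderOf_injective (C.mapPoint W) (C.mapPoint_injective W) _).trans hord
  rw [C.mapPoint_some] at hord'
  have hX : C.mapX 0 = 0 := by simp [C, VariableChange.mapX]
  have hY : C.mapY 0 0 = 0 := by simp [C, VariableChange.mapY]
  have hn' := C.nonsingular_map W hn
  simp only [hX, hY] at hord' hn'
  refine exists_point_of_tateNormalForm (W := (C • W).toAffine) (b := -(W.a₂ ^ 3 / W.a₃ ^ 2))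
    (c := 1 - W.a₁ * W.a₂ / W.a₃) ?_ ?_ ?_ ?_ ?_ ?_ hn' hord'
  · simp [C, u, variableChange_def]; field_simp
  · simp [C, u, variableChange_def]; field_simp
  · simp [C, u, variableChange_def]; field_simp
  · simp [C, u, variableChange_def, ha₄]
  · simp [C, u, variableChange_def, ha₄, ha₆]
  · simp [ha₂, ha₃]

/-- An elliptic curve with a point of order `11` gives a noncuspidal point of `X₁(11)`. -/
theorem exists_point_of_order_eleven (E : WeierstrassCurve K) [E.IsElliptic] (P : E.toAffine.Point)
    (hP : addOrderOf P = 11) : ∃ x y : K, y ^ 2 - y = x ^ 3 - x ^ 2 ∧ x ≠ 0 ∧ x ≠ 1 := by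
  rcases P with _ | ⟨x₀, y₀, h₀⟩
  · rw [← Affine.Point.zero_def, addOrderOf_zero] at hP; norm_num at hP
  have ha3 : E.a₃ + x₀ * E.a₁ + 2 * y₀ ≠ 0 := by
    intro h
    apply nsmul_ne_zero_of_addOrderOf hP (k := 2) (by norm_num) (by norm_num)
    rw [two_nsmul]
    exact Affine.Point.add_self_of_Y_eq (by rw [Affine.negY]; linear_combination h)
  obtain ⟨s, hs⟩ : ∃ s, s * (E.a₃ + x₀ * E.a₁ + 2 * y₀) =
      E.a₄ + 2 * x₀ * E.a₂ - y₀ * E.a₁ + 3 * x₀ ^ 2 := ⟨_, div_mul_cancel₀ _ ha3⟩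
  -- Moves P to the origin and its tangent, of slope s, to Y = 0, which removes a₆ and a₄. The
  -- tangent is not vertical because 2P ≠ 0.
  let C : VariableChange K := ⟨1, x₀, s, y₀⟩
  have heq := (Affine.equation_iff ..).mp h₀.1
  have hW4 : (C • E).a₄ = 0 := by
    simp only [C, variableChange_def, inv_one, Units.val_one]; linear_combination -hs
  have hW6 : (C • E).a₆ = 0 := by
    simp only [C, variableChange_def, inv_one, Units.val_one]; linear_combination -heq
  have hW3 : (C • E).a₃ ≠ 0 := by
    simpa [C, variableChange_def] using ha3
  have hord := (addOrderOf_injective (C.mapPoint E) (C.mapPoint_injective E) _).trans hP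
  rw [C.mapPoint_some] at hord
  have hX : C.mapX x₀ = 0 := by simp [C, VariableChange.mapX]
  have hY : C.mapY x₀ y₀ = 0 := by simp [C, VariableChange.mapY]
  have hE : (C • E).IsElliptic := inferInstance
  have hn := C.nonsingular_map E h₀
  simp only [hX, hY] at hord hn
  exact exists_point_of_origin hW4 hW6 hW3 hn hord

end

/-! ### Quadratic fields of small discriminant -/

namespace IsQuadraticField

variable {K : Type*} [Field K] [NumberField K]

/-- The ring of integers of a quadratic field is `ℤ[ω]` for some `ω`. -/
lemma exists_basis (hK : IsQuadraticField K) : ∃ b : Module.Basis (Fin 2) ℤ (𝓞 K), b 0 = 1 := by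
  have hr : Module.finrank ℤ (𝓞 K) = 2 := (RingOfIntegers.rank K).trans hK
  let b : Module.Basis (Fin 2) ℤ (𝓞 K) := Module.finBasisOfFinrankEq ℤ (𝓞 K) hr
  obtain ⟨u, hu⟩ : ∃ u, u = b.repr 1 := ⟨_, rfl⟩
  have h1 : (1 : 𝓞 K) = u 0 • b 0 + u 1 • b 1 := by
    rw [hu, ← Fin.sum_univ_two (fun i => b.repr 1 i • b i), b.sum_repr]
  -- The vector of 1 is primitive: if g divides 1 in the ring, it divides the basis vector b₀ as
  -- well. A Bézout relation then completes 1 to a basis.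
  have hcop : IsCoprime (u 0) (u 1) := by
    rw [Int.isCoprime_iff_gcd_eq_one]
    obtain ⟨m, hm⟩ := Int.gcd_dvd_left (a := u 0) (b := u 1)
    obtain ⟨n, hn⟩ := Int.gcd_dvd_right (a := u 0) (b := u 1)
    set g := Int.gcd (u 0) (u 1)
    have h2 : b 0 = (g : ℤ) • ((m • b 0 + n • b 1) * b 0) := by
      have h3 : (g : ℤ) • (m • b 0 + n • b 1) = (1 : 𝓞 K) := by
        rw [h1, smul_add, smul_smul, smul_smul, ← hm, ← hn]
      rw [← smul_mul_assoc, h3, one_mul]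
    have h4 := congrArg (fun z => b.repr z 0) h2
    simp only [map_smul, Module.Basis.repr_self, Finsupp.smul_apply, Finsupp.single_eq_same,
      smul_eq_mul] at h4
    have := Int.eq_one_or_neg_one_of_mul_eq_one h4.symm
    omega
  obtain ⟨p, q, hpq⟩ := hcop
  let e : Fin 2 → 𝓞 K := ![1, -q • b 0 + p • b 1]
  have hspan : ⊤ ≤ Submodule.span ℤ (Set.range e) := by
    rw [← b.span_eq, Submodule.span_le]
    have he0 : (1 : 𝓞 K) ∈ Submodule.span ℤ (Set.range e) := Submodule.subset_span ⟨0, rfl⟩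
    have he1 : -q • b 0 + p • b 1 ∈ Submodule.span ℤ (Set.range e) :=
      Submodule.subset_span ⟨1, rfl⟩
    rintro _ ⟨i, rfl⟩
    fin_cases i
    · have : b 0 = p • 1 - u 1 • (-q • b 0 + p • b 1) := by
        rw [h1]
        linear_combination (exp := 1) -(congrArg (· • b 0) hpq)
      simp only [Fin.zero_eta]
      rw [this]
      exact sub_mem (Submodule.smul_mem _ _ he0) (Submodule.smul_mem _ _ he1)
    · have : b 1 = q • 1 + u 0 • (-q • b 0 + p • b 1) := by
        rw [h1]
        linear_combination (exp := 1) -(congrArg (· • b 1) hpq)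
      simp only [Fin.mk_one]
      rw [this]
      exact add_mem (Submodule.smul_mem _ _ he0) (Submodule.smul_mem _ _ he1)
  refine ⟨basisOfTopLeSpanOfCardEqFinrank e hspan (by rw [hr, Fintype.card_fin]), ?_⟩
  simp [e]

lemma discr_eq (b : Module.Basis (Fin 2) ℤ (𝓞 K)) (hb : b 0 = 1) :
    discr K = b.repr (b 1 ^ 2) 1 ^ 2 + 4 * b.repr (b 1 ^ 2) 0 := by
  have hsq : b 1 ^ 2 = algebraMap ℤ _ (b.repr (b 1 ^ 2) 0) + b.repr (b 1 ^ 2) 1 • b 1 := by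
    conv_lhs => rw [← b.sum_repr (b 1 ^ 2)]
    rw [Fin.sum_univ_two, hb, Algebra.algebraMap_eq_smul_one]
  have ht0 : Algebra.trace ℤ (𝓞 K) 1 = 2 := by
    rw [← map_one (algebraMap ℤ (𝓞 K)), Algebra.trace_algebraMap_of_basis b]; simp
  have ht1 : Algebra.trace ℤ (𝓞 K) (b 1) = b.repr (b 1 ^ 2) 1 := by
    rw [Algebra.trace_eq_matrix_trace b, Matrix.trace_fin_two, Algebra.leftMulMatrix_eq_repr_mul,
      Algebra.leftMulMatrix_eq_repr_mul, hb, mul_one, ← sq]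
    simp
  have ht2 : Algebra.trace ℤ (𝓞 K) (b 1 ^ 2) =
      2 * b.repr (b 1 ^ 2) 0 + b.repr (b 1 ^ 2) 1 ^ 2 := by
    conv_lhs => rw [hsq]
    rw [map_add, map_smul, ht1, Algebra.trace_algebraMap_of_basis b]
    simp [sq]
  rw [← discr_eq_discr K b, Algebra.discr_def, Matrix.det_fin_two]
  simp only [Algebra.traceMatrix_apply, Algebra.traceForm_apply, hb, one_mul, mul_one, ht1,
    ← sq, one_pow, ht0, ht2]
  ring

/-- The ring of integers of a quadratic field is `ℤ[ω]` with `ω² = x + y ω` and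
`y² + 4 x` the discriminant. -/
lemma exists_generator (hK : IsQuadraticField K) : ∃ (ω : 𝓞 K) (x y : ℤ), ω ^ 2 = x + y * ω ∧
    discr K = y ^ 2 + 4 * x ∧ (∀ z : 𝓞 K, ∃ m n : ℤ, z = m + n * ω) ∧
    ∀ m n : ℤ, (m : 𝓞 K) + n * ω = 0 → m = 0 ∧ n = 0 := by
  obtain ⟨b, hb⟩ := hK.exists_basis
  have hall (z : 𝓞 K) : z = (b.repr z 0 : ℤ) + (b.repr z 1 : ℤ) * b 1 := by
    conv_lhs => rw [← b.sum_repr z]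
    rw [Fin.sum_univ_two, hb]
    simp
  refine ⟨b 1, b.repr (b 1 ^ 2) 0, b.repr (b 1 ^ 2) 1, hall _, discr_eq b hb,
    fun z => ⟨_, _, hall z⟩, fun m n h => ?_⟩
  have h1 : m • b 0 + n • b 1 = 0 := by rw [hb]; simpa using h
  have h2 := Fintype.linearIndependent_iff.mp b.linearIndependent ![m, n] (by
    rw [Fin.sum_univ_two]; simpa using h1)
  exact ⟨h2 0, h2 1⟩

/-- A quadratic field of absolute discriminant at most `7` is one of `ℚ(i)`, `ℚ(√-3)`, `ℚ(√5)` and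
`ℚ(√-7)`. -/
lemma exists_sq_eq (hK : IsQuadraticField K) (hd : |discr K| ≤ 7) :
    (∃ s : K, s ^ 2 = -1) ∨ (∃ s : K, s ^ 2 = -3) ∨ (∃ s : K, s ^ 2 = 5) ∨
      (discr K = -7 ∧ ∃ s : K, s ^ 2 = -7) := by
  obtain ⟨ω, x, y, hω, hD, -, hli⟩ := hK.exists_generator
  have h2 : 2 < |discr K| := abs_discr_gt_two (by rw [hK]; norm_num)
  have hs : (2 * ω - y) ^ 2 = ((y ^ 2 + 4 * x : ℤ) : 𝓞 K) := by
    push_cast; linear_combination 4 * hω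
  rw [← hD] at hs
  have hmod : discr K % 4 = 0 ∨ discr K % 4 = 1 := by
    rcases Int.even_or_odd' y with ⟨k, rfl | rfl⟩
    · left; rw [hD]; ring_nf; omega
    · right; rw [hD]; ring_nf; omega
  have hs' : (2 * (ω : K) - y) ^ 2 = (discr K : K) := by
    have := congrArg (algebraMap (𝓞 K) K) hs
    simpa only [map_pow, map_sub, map_mul, map_ofNat, map_intCast] using this
  -- If Δ were 4, then 2ω - y = ±2, against the independence of 1 and ω. With |Δ| > 2 and Δ ≡ 0, 1
  -- modulo 4 this leaves -7, -4, -3, 5.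
  have h4 : discr K ≠ 4 := by
    intro h4
    rw [h4] at hs
    have : (2 * ω - y - 2) * (2 * ω - y + 2) = 0 := by
      push_cast at hs; linear_combination hs
    rcases mul_eq_zero.mp this with h | h
    · have := (hli (-y - 2) 2 (by push_cast; linear_combination h)).2
      omega
    · have := (hli (-y + 2) 2 (by push_cast; linear_combination h)).2
      omega
  generalize discr K = D at *
  have hb := abs_le.mp hd
  have hcases : D = -7 ∨ D = -4 ∨ D = -3 ∨ D = 5 := by
    rcases abs_cases D with ⟨h, -⟩ | ⟨h, -⟩ <;> omega
  rcases hcases with rfl | rfl | rfl | rfl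
  · exact Or.inr (Or.inr (Or.inr ⟨rfl, _, by rw [hs']; norm_num⟩))
  · exact Or.inl ⟨(2 * ω - y) / 2, by rw [div_pow, hs']; norm_num⟩
  · exact Or.inr (Or.inl ⟨_, by rw [hs']; norm_num⟩)
  · exact Or.inr (Or.inr (Or.inl ⟨_, by rw [hs']; norm_num⟩))

/-- A quadratic field with a square root of `d` is isomorphic to `ℚ(√d)`. -/
lemma nonempty_ringEquiv (hK : IsQuadraticField K) {d : ℚ} [Fact (∀ r : ℚ, r ^ 2 ≠ d + 0 * r)]
    {s : K} (hs : s ^ 2 = (d : K)) : Nonempty (K ≃+* QuadField d) := by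
  let f : QuadraticAlgebra ℚ d 0 →ₐ[ℚ] K := QuadraticAlgebra.lift ⟨s, by
    rw [← sq, hs, zero_smul, add_zero, Algebra.smul_def, mul_one, eq_ratCast]⟩
  have hinj : Function.Injective f := f.toRingHom.injective
  have hsurj : Function.Surjective f :=
    (LinearMap.injective_iff_surjective_of_finrank_eq_finrank (f := f.toLinearMap)
      ((QuadraticAlgebra.finrank_eq_two d 0).trans hK.symm)).mp hinj
  exact ⟨(RingEquiv.ofBijective f ⟨hinj, hsurj⟩).symm⟩

end IsQuadraticField

namespace QuadField

lemma sqrtGen_sq (d : ℚ) : sqrtGen d ^ 2 = ⟨d, 0⟩ := by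
  rw [sq]
  ext <;> simp [sqrtGen]

lemma isQuadraticField (d : ℚ) [Fact (∀ r : ℚ, r ^ 2 ≠ d + 0 * r)] :
    IsQuadraticField (QuadField d) := by
  have h := QuadraticAlgebra.finrank_eq_two d (0 : ℚ)
  unfold IsQuadraticField
  convert h

/-- Writing the integer (1 + √-7)/2 as m + nω and squaring gives n²Δ = -7, so n² = 1; the case n = 0
would make -7 a square in ℤ. -/
lemma discr_neg_seven : discr (QuadField (-7)) = -7 := by
  obtain ⟨ω, x, y, hω, hD, hall, hli⟩ := (isQuadraticField (-7)).exists_generator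
  have hs : sqrtGen (-7) ^ 2 = -7 := by
    rw [sqrtGen_sq]; rfl
  have hint : _root_.IsIntegral ℤ ((1 + sqrtGen (-7)) / 2) := by
    refine ⟨Polynomial.X ^ 2 - Polynomial.X + 2, by monicity!, ?_⟩
    simp only [Polynomial.eval₂_add, Polynomial.eval₂_sub, Polynomial.eval₂_pow,
      Polynomial.eval₂_X, Polynomial.eval₂_ofNat]
    linear_combination hs / 4
  obtain ⟨m, n, hmn⟩ := hall ⟨_, hint⟩
  have h7 : (2 * (m + n * ω) - 1) ^ 2 = -7 := by
    have hmn' : (1 + sqrtGen (-7)) / 2 = m + n * (ω : QuadField (-7)) := by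
      have := congrArg (algebraMap _ (QuadField (-7))) hmn
      simp only [map_add, map_mul, map_intCast] at this
      exact this
    apply RingOfIntegers.coe_injective
    simp only [map_pow, map_add, map_sub, map_mul, map_ofNat, map_one, map_neg, map_intCast]
    rw [← hmn']
    linear_combination hs
  have h8 := hli ((2 * m + n * y - 1) ^ 2 + n ^ 2 * discr (QuadField (-7)) + 7 -
    2 * (2 * m + n * y - 1) * n * y) (4 * (2 * m + n * y - 1) * n) (by
      rw [hD]; push_cast; linear_combination h7 - 4 * n ^ 2 * hω)
  obtain ⟨h8, h9⟩ := h8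
  rcases mul_eq_zero.mp h9 with h | h
  · have hA : 2 * m + n * y - 1 = 0 := by omega
    rw [hA] at h8
    have h10 : n ^ 2 * discr (QuadField (-7)) = -7 := by linarith
    have hn : n ^ 2 ∣ 7 := ⟨-discr (QuadField (-7)), by linarith⟩
    have : n ^ 2 = 1 := by
      have h11 : n ^ 2 ≤ 7 := Int.le_of_dvd (by norm_num) hn
      have h12 : n ≤ 2 := by nlinarith
      have h13 : -2 ≤ n := by nlinarith
      interval_cases n <;> omega
    rw [this] at h10
    linarith
  · rw [h] at h8
    nlinarith
end QuadField

/-! ### The explicit curve: nonsingularity and the point of order 11 -/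

section

variable {F : Type*} [Field F] [CharZero F] {s : F}

lemma isElliptic_of_sqrt_neg_seven {W : WeierstrassCurve F} (hs : s ^ 2 = -7) (ha₁ : W.a₁ = (85 + 33 * s) / 128)
    (ha₂ : W.a₂ = (89 * s - 275) / 4096) (ha₃ : W.a₃ = (85 * s - 999) / 16384) (ha₄ : W.a₄ = 0)
    (ha₆ : W.a₆ = 0) : W.IsElliptic := by
  have hΔ : W.Δ = (69525816908531 - 7071418302969 * s) / 4611686018427387904 := by
    simp only [Δ, b₂, b₄, b₆, b₈, ha₁, ha₂, ha₃, ha₄, ha₆]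
    linear_combination ((-3516225510575243/295147905179352825856) + (1353346513088583/295147905179352825856) * s + (-545857236312289/147573952589676412928) * s ^ 2 + (29855748193373/147573952589676412928) * s ^ 3 + (11136376018845/295147905179352825856) * s ^ 4 + (-762576851025/295147905179352825856) * s ^ 5) * hs
  refine ⟨isUnit_iff_ne_zero.mpr fun h => one_ne_zero (α := F) ?_⟩
  rw [hΔ] at h
  -- Multiplication by the conjugate turns the discriminant into a nonzero rational number.
  linear_combination ((69525816908531 + 7071418302969 * s) / 1124073472) * h - ((-50004956815564971874214961/5183873914507529901140082688)) * hs

/-- Explicit chords and tangents give 2P, 3P, 4P and 8P. The last is -3P, so 11P = 0, and 11 is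
prime. -/
lemma addOrderOf_of_sqrt_neg_seven [DecidableEq F] {W : Affine F} [W.IsElliptic] (hs : s ^ 2 = -7)
    (ha₁ : W.a₁ = (85 + 33 * s) / 128)
    (ha₂ : W.a₂ = (89 * s - 275) / 4096) (ha₃ : W.a₃ = (85 * s - 999) / 16384) (ha₄ : W.a₄ = 0)
    (ha₆ : W.a₆ = 0)
    (h0 : W.Nonsingular 0 0) : addOrderOf (Affine.Point.some 0 0 h0) = 11 := by
  have n2 : W.Nonsingular ((275 - 89 * s) / 4096) ((-5983 - 2115 * s) / 262144) := by
    rw [← Affine.equation_iff_nonsingular, Affine.equation_iff, ha₁, ha₂, ha₃, ha₄, ha₆]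
    linear_combination ((17572071/137438953472) + (6211755/137438953472) * s) * hs
  have h2 : Affine.Point.some _ _ h0 + .some _ _ h0 = .some _ _ n2 :=
    Affine.Point.add_eq_some (ℓ := 0) n2
      (Or.inr ⟨rfl, rfl, by
        rw [ha₁, ha₃]
        exact fun h => one_ne_zero (α := F) (by linear_combination ((-999 - 85 * s) / 64) * h - ((-7225/1048576)) * hs), by
        rw [ha₁, ha₂, ha₃, ha₄]; linear_combination (0) * hs⟩)
      (by rw [ha₁, ha₂]; linear_combination (0) * hs)
      (by rw [ha₁, ha₃]; linear_combination ((-2937/524288)) * hs)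
  have n3 : W.Nonsingular ((47 - 45 * s) / 512) ((-1201 + 627 * s) / 16384) := by
    rw [← Affine.equation_iff_nonsingular, Affine.equation_iff, ha₁, ha₂, ha₃, ha₄, ha₆]
    linear_combination ((49533/67108864) + (-23895/67108864) * s) * hs
  have h3 : Affine.Point.some _ _ n2 + .some _ _ h0 = .some _ _ n3 :=
    Affine.Point.add_eq_some (ℓ := (-5 - 17 * s) / 128) n3
      (Or.inl ⟨sub_ne_zero.mp (fun h => one_ne_zero (α := F) (by linear_combination ((275 + 89 * s) / 32) * h - ((-7921/131072)) * hs)),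
        by linear_combination ((1513/524288)) * hs⟩)
      (by rw [ha₁, ha₂]; linear_combination ((17/1024)) * hs)
      (by rw [ha₁, ha₃]; linear_combination ((-7273/524288)) * hs)
  have n4 : W.Nonsingular ((-87 - 91 * s) / 2048) ((393 + 1541 * s) / 131072) := by
    rw [← Affine.equation_iff_nonsingular, Affine.equation_iff, ha₁, ha₂, ha₃, ha₄, ha₆]
    linear_combination ((-297441/34359738368) + (-3087357/34359738368) * s) * hs
  have h4 : Affine.Point.some _ _ n3 + .some _ _ h0 = .some _ _ n4 :=
    Affine.Point.add_eq_some (ℓ := (-31 - 3 * s) / 64) n4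
      (Or.inl ⟨sub_ne_zero.mp (fun h => one_ne_zero (α := F) (by linear_combination ((47 + 45 * s) / 32) * h - ((-2025/16384)) * hs)),
        by linear_combination ((135/32768)) * hs⟩)
      (by rw [ha₁, ha₂]; linear_combination ((81/8192)) * hs)
      (by rw [ha₁, ha₃]; linear_combination ((-3537/262144)) * hs)
  have n8 : W.Nonsingular ((47 - 45 * s) / 512) ((-2795 - 287 * s) / 32768) := by
    rw [← Affine.equation_iff_nonsingular, Affine.equation_iff, ha₁, ha₂, ha₃, ha₄, ha₆]
    linear_combination ((2168661/2147483648) + (1523745/2147483648) * s) * hs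
  have h8 : Affine.Point.some _ _ n4 + .some _ _ n4 = .some _ _ n8 :=
    Affine.Point.add_eq_some (ℓ := (-75 + 1 * s) / 128) n8
      (Or.inr ⟨rfl, rfl, by
        rw [ha₁, ha₃]
        exact fun h => one_ne_zero (α := F) (by linear_combination ((-393 + 1541 * s) / 128) * h - ((-3569183/33554432) + (-4627623/33554432) * s) * hs), by
        rw [ha₁, ha₂, ha₃, ha₄]; linear_combination ((189897/33554432) + (-3003/33554432) * s) * hs⟩)
      (by rw [ha₁, ha₂]; linear_combination ((-17/8192)) * hs)
      (by rw [ha₁, ha₃]; linear_combination ((-6029/262144)) * hs)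
  have h11 : Affine.Point.some _ _ n8 + .some _ _ n3 = 0 :=
    Affine.Point.add_of_Y_eq rfl (by
      rw [Affine.negY, ha₁, ha₃]; linear_combination ((-1485/65536)) * hs)
  have : Fact (Nat.Prime 11) := ⟨by norm_num⟩
  refine addOrderOf_eq_prime ?_ (Affine.Point.some_ne_zero _)
  rw [← h8, ← h4, ← h3, ← h2] at h11
  rw [← h11]
  abel

end

/-! ### A point of infinite order over ℚ(√-7) -/

/-- Since 2q would be a root of the irreducible cubic. It excludes 2-torsion with rational abscissa,
so such points can be doubled by a tangent. -/
lemma four_mul_cube_sub_ne_zero (q : ℚ) : 4 * q ^ 3 - 4 * q ^ 2 + 1 ≠ 0 := by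
  intro h
  refine CubicField.irreducible_cubicPoly.not_isRoot_of_natDegree_ne_one
    (by rw [CubicField.natDegree_cubicPoly]; norm_num) (x := 2 * q) ?_
  simp only [Polynomial.IsRoot, cubicPoly, Polynomial.eval_add, Polynomial.eval_sub,
    Polynomial.eval_mul, Polynomial.eval_pow, Polynomial.eval_X, Polynomial.eval_ofNat]
  linear_combination 2 * h

section

variable {F : Type*} [Field F]

lemma modularX1_11_nonsingular_of_eq {x y : F} (h : y ^ 2 - y = x ^ 3 - x ^ 2)
    (hy : 2 * y - 1 ≠ 0) : (modularX1_11 F).toAffine.Nonsingular x y := by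
  rw [Affine.nonsingular_iff', Affine.equation_iff]
  simp only [modularX1_11]
  exact ⟨by linear_combination h, Or.inr fun h => hy (by linear_combination h)⟩

variable [CharZero F] {s : F}

lemma exists_variableChange_universalCurve11 (hs : s ^ 2 = -7) : ∃ C : VariableChange F,
    C.r = 0 ∧ C.t = 0 ∧ C • universalCurve11 ((5 + s) / 8) ((11 - s) / 16) =
      ⟨(85 + 33 * s) / 128, (89 * s - 275) / 4096, (85 * s - 999) / 16384, 0, 0⟩ := by
  -- A unit because 25 + 7 = 32; its inverse happens to be the abscissa of the chosen point.
  let u : Fˣ := ⟨(5 - s) / 4, (5 + s) / 8, by linear_combination (-1 / 32) * hs,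
    by linear_combination (-1 / 32) * hs⟩
  have hx : (5 + s) / 8 ≠ 0 := fun h =>
    one_ne_zero (α := F) (by linear_combination ((5 - s) / 4) * h + hs / 32)
  have hc : (11 - s) / 16 * ((11 - s) / 16 - (5 + s) / 8) / ((5 + s) / 8) = (-9 - 5 * s) / 32 := by
    rw [div_eq_iff hx]
    linear_combination (1 / 32) * hs
  have hu : ((u⁻¹ : Fˣ) : F) = (5 + s) / 8 := rfl
  refine ⟨⟨u, 0, 0, 0⟩, rfl, rfl, ?_⟩
  rw [universalCurve11, hc]
  ext <;> simp only [variableChange_def, tateNormalForm, hu]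
  · linear_combination (5 / 256) * hs
  · linear_combination (475 / 32768 + 21 / 8192 * s + 5 / 32768 * s ^ 2) * hs
  · linear_combination (3087 / 262144 + 895 / 262144 * s + 109 / 262144 * s ^ 2 +
      5 / 262144 * s ^ 3) * hs
  · ring
  · ring

variable [DecidableEq F]

/-- Duplication of abscissas is defined over ℚ, so the height argument works although y need not be
rational. -/
lemma exists_add_self {q : ℚ} {y : F} (h : (modularX1_11 F).toAffine.Nonsingular q y)
    (hq : 4 ≤ naiveHeight q) : ∃ (q' : ℚ) (y' : F) (h' : (modularX1_11 F).toAffine.Nonsingular q' y'),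
      Affine.Point.some _ _ h + .some _ _ h = .some _ _ h' ∧ naiveHeight q < naiveHeight q' := by
  have heq : y ^ 2 - y = (q : F) ^ 3 - (q : F) ^ 2 := by
    have := (Affine.equation_iff ..).mp h.1
    simp only [modularX1_11] at this
    linear_combination this
  have hsq : (2 * y - 1) ^ 2 = 4 * (q : F) ^ 3 - 4 * (q : F) ^ 2 + 1 := by linear_combination 4 * heq
  have hne := four_mul_cube_sub_ne_zero q
  have hne' : 4 * (q : F) ^ 3 - 4 * (q : F) ^ 2 + 1 ≠ 0 := by exact_mod_cast hne
  have hy : 2 * y - 1 ≠ 0 := fun h0 => hne' (by rw [← hsq, h0]; ring)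
  obtain ⟨l, hl⟩ : ∃ l, l * (2 * y - 1) = 3 * (q : F) ^ 2 - 2 * q := ⟨_, div_mul_cancel₀ _ hy⟩
  obtain ⟨q', hq'⟩ : ∃ q', q' * (4 * q ^ 3 - 4 * q ^ 2 + 1) = q ^ 4 - 2 * q + 1 :=
    ⟨_, div_mul_cancel₀ _ hne⟩
  have hqF : (q' : F) * (4 * (q : F) ^ 3 - 4 * (q : F) ^ 2 + 1) = (q : F) ^ 4 - 2 * q + 1 := by
    exact_mod_cast hq'
  have hx : (q' : F) = l ^ 2 + 1 - 2 * q := by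
    apply mul_right_cancel₀ hne'
    rw [hqF]
    linear_combination -(l * (2 * y - 1) + (3 * (q : F) ^ 2 - 2 * q)) * hl + l ^ 2 * hsq
  have heq' : (1 - l * (q' - q) - y) ^ 2 - (1 - l * (q' - q) - y) = (q' : F) ^ 3 - (q' : F) ^ 2 := by
    linear_combination heq + ((q' : F) - q) * hl - ((q' : F) - q) ^ 2 * hx
  have hy' : 2 * (1 - l * (q' - q) - y) - 1 ≠ 0 := by
    intro h0
    have h1 : 4 * (q' : F) ^ 3 - 4 * (q' : F) ^ 2 + 1 = 0 := by
      linear_combination -4 * heq' + (2 * (1 - l * (q' - q) - y) - 1) * h0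
    exact four_mul_cube_sub_ne_zero q' (by exact_mod_cast h1)
  refine ⟨q', _, modularX1_11_nonsingular_of_eq heq' hy', ?_, naiveHeight_lt_of_double hq' hq⟩
  refine Affine.Point.add_eq_some (ℓ := l) _ (Or.inr ⟨rfl, rfl, ?_, ?_⟩) ?_ ?_
  · simp only [modularX1_11]
    exact fun h0 => hy (by linear_combination h0)
  · simp only [modularX1_11]
    linear_combination hl
  · simp only [modularX1_11]
    linear_combination hx
  · simp only [modularX1_11]
    ring

/-- Heights grow under doubling, so a point with a rational `x`-coordinate of height at least `4`
has infinite order. -/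
lemma not_isOfFinAddOrder_of_naiveHeight {q : ℚ} {y : F}
    (h : (modularX1_11 F).toAffine.Nonsingular q y) (hq : 4 ≤ naiveHeight q) :
    ¬ IsOfFinAddOrder (Affine.Point.some _ _ h) := by
  intro hfin
  rw [← finite_multiples] at hfin
  set M := AddSubmonoid.multiples (Affine.Point.some _ _ h)
  let X : (modularX1_11 F).toAffine.Point → F
    | .zero => 0
    | .some x _ _ => x
  let T : Set ℚ := {r | 4 ≤ naiveHeight r ∧
    ∃ (z : F) (h' : (modularX1_11 F).toAffine.Nonsingular r z), Affine.Point.some _ _ h' ∈ M}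
  have hT : T.Finite := by
    refine ((hfin.image X).preimage (f := ((↑) : ℚ → F)) Rat.cast_injective.injOn).subset ?_
    rintro r ⟨-, z, h', hr⟩
    exact ⟨_, hr, rfl⟩
  -- A multiple of maximal height is contradicted by its double.
  obtain ⟨r, ⟨hr, z, h', hz⟩, hmax⟩ := Set.exists_max_image T naiveHeight hT
    ⟨q, hq, y, h, AddSubmonoid.mem_multiples _⟩
  obtain ⟨r', z', h'', hadd, hlt⟩ := exists_add_self h' hr
  exact (hmax r' ⟨by omega, z', h'', hadd ▸ add_mem hz hz⟩).not_gt hlt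

/-- Doubling runs (1, 0), (0, 0), (1, 1) = -(1, 0), so 5 kills the point. -/
lemma isOfFinAddOrder_one_zero (h : (modularX1_11 F).toAffine.Nonsingular 1 0) :
    IsOfFinAddOrder (Affine.Point.some _ _ h) := by
  have h0 : (modularX1_11 F).toAffine.Nonsingular 0 0 :=
    modularX1_11_nonsingular (Or.inl rfl) (Or.inl rfl)
  have h1 : (modularX1_11 F).toAffine.Nonsingular 1 1 :=
    modularX1_11_nonsingular (Or.inr rfl) (Or.inr rfl)
  have e1 : Affine.Point.some _ _ h + .some _ _ h = .some _ _ h0 :=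
    Affine.Point.add_eq_some (ℓ := -1) h0 (Or.inr ⟨rfl, rfl, by simp [modularX1_11],
      by simp only [modularX1_11]; ring⟩) (by simp only [modularX1_11]; ring)
      (by simp only [modularX1_11]; ring)
  have e2 : Affine.Point.some _ _ h0 + .some _ _ h0 = .some _ _ h1 :=
    Affine.Point.add_eq_some (ℓ := 0) h1 (Or.inr ⟨rfl, rfl, by simp [modularX1_11],
      by simp only [modularX1_11]; ring⟩) (by simp only [modularX1_11]; ring)
      (by simp only [modularX1_11]; ring)
  have e3 : Affine.Point.some _ _ h1 + .some _ _ h = 0 :=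
    Affine.Point.add_of_Y_eq rfl (by simp [modularX1_11, Affine.negY])
  rw [isOfFinAddOrder_iff_nsmul_eq_zero]
  refine ⟨5, by norm_num, ?_⟩
  rw [← e2, ← e1] at e3
  rw [← e3]
  abel

/-- The abscissa (5 + s)/8 is not rational, so heights are applied to a translate: subtracting the
torsion point (1, 0) leaves (-1, (1 + s)/2), and doubling makes the abscissa -4/7, of height 7. -/
lemma exists_infinite_order_of_sqrt_neg_seven (hs : s ^ 2 = -7) :
    ∃ h : (modularX1_11 F).toAffine.Nonsingular ((5 + s) / 8) ((11 - s) / 16),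
      ¬ IsOfFinAddOrder (Affine.Point.some _ _ h) := by
  have hs0 : s ≠ 0 := by
    rintro rfl
    norm_num at hs
  have h1 : (modularX1_11 F).toAffine.Nonsingular (-1) ((1 + s) / 2) :=
    modularX1_11_nonsingular_of_eq (by linear_combination hs / 4)
      (fun h => hs0 (by linear_combination h))
  have hT : (modularX1_11 F).toAffine.Nonsingular 1 0 :=
    modularX1_11_nonsingular (Or.inr rfl) (Or.inl rfl)
  have hP : (modularX1_11 F).toAffine.Nonsingular ((5 + s) / 8) ((11 - s) / 16) :=
    modularX1_11_nonsingular_of_eq (by linear_combination (-(5 / 512) - s / 512) * hs)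
      (fun h => one_ne_zero (α := F) (by linear_combination ((3 + s) / 2) * h + hs / 16))
  have h2 : (modularX1_11 F).toAffine.Nonsingular ((-4 / 7 : ℚ) : F) (1 / 2 - 19 / 98 * s) :=
    modularX1_11_nonsingular_of_eq (by push_cast; linear_combination (361 / 9604) * hs)
      (fun h => hs0 (by linear_combination (-49 / 19) * h))
  have e1 : Affine.Point.some _ _ h1 + .some _ _ hT = .some _ _ hP := by
    refine Affine.Point.add_eq_some (ℓ := (-1 - s) / 4) hP (Or.inl ⟨by norm_num, ?_⟩) ?_ ?_
    · ring
    · simp only [modularX1_11]; linear_combination (-1 / 16) * hs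
    · simp only [modularX1_11]; linear_combination (-1 / 32) * hs
  have e2 : Affine.Point.some _ _ h1 + .some _ _ h1 = .some _ _ h2 := by
    refine Affine.Point.add_eq_some (ℓ := -5 * s / 7) h2 (Or.inr ⟨rfl, rfl, ?_, ?_⟩) ?_ ?_
    · simp only [modularX1_11]; exact fun h => hs0 (by linear_combination h)
    · simp only [modularX1_11]; linear_combination (-5 / 7) * hs
    · simp only [modularX1_11]; push_cast; linear_combination (-25 / 49) * hs
    · simp only [modularX1_11]; push_cast; ring
  refine ⟨hP, fun hfin => ?_⟩
  have h3 : IsOfFinAddOrder (Affine.Point.some _ _ h1) := by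
    rw [eq_sub_of_add_eq e1, sub_eq_add_neg]
    exact hfin.add (isOfFinAddOrder_one_zero hT).neg
  refine not_isOfFinAddOrder_of_naiveHeight h2 ?_ (e2 ▸ h3.add h3)
  norm_num [naiveHeight]

end

/-! ### Integrality and reduction of torsion points at an unramified place above 3 -/

lemma AbsoluteValue.mul_le_of_le_one {F : Type*} [Field F] {v : AbsoluteValue F ℚ} {a b : F} {c : ℚ} (ha : v a ≤ 1)
    (hb : v b ≤ c) : v (a * b) ≤ c := by
  rw [map_mul]
  exact (mul_le_of_le_one_left (v.nonneg b) ha).trans hb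

/-- A nonarchimedean absolute value with the properties of an unramified extension of the
`3`-adic one. -/
structure AbsoluteValue.IsThreeAdic {F : Type*} [Field F] (v : AbsoluteValue F ℚ) : Prop where
  add_le' : ∀ a b, v (a + b) ≤ max (v a) (v b)
  two : v 2 = 1
  three : v 3 = 1 / 3
  three_le {a : F} : 1 < v a → 3 ≤ v a

namespace AbsoluteValue.IsThreeAdic

variable {F : Type*} [Field F] {v : AbsoluteValue F ℚ} (hv : v.IsThreeAdic) {a b : F} {c : ℚ}

include hv

lemma add_le (ha : v a ≤ c) (hb : v b ≤ c) : v (a + b) ≤ c :=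
  (hv.add_le' a b).trans (max_le ha hb)

lemma sub_le (ha : v a ≤ c) (hb : v b ≤ c) : v (a - b) ≤ c := by
  rw [sub_eq_add_neg]; exact hv.add_le ha (by rwa [v.map_neg])

lemma add_lt (ha : v a < c) (hb : v b < c) : v (a + b) < c :=
  (hv.add_le' a b).trans_lt (max_lt ha hb)

lemma sub_lt (ha : v a < c) (hb : v b < c) : v (a - b) < c := by
  rw [sub_eq_add_neg]; exact hv.add_lt ha (by rwa [v.map_neg])

lemma add_eq (h : v b < v a) : v (a + b) = v a := by
  refine le_antisymm (hv.add_le le_rfl h.le) (not_lt.mp fun h' => ?_)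
  have := hv.sub_lt h' h
  rw [add_sub_cancel_right] at this
  exact lt_irrefl _ this

end AbsoluteValue.IsThreeAdic

/-- The coefficients of a Weierstrass curve are integral for an absolute value. -/
structure WeierstrassCurve.IsIntegralFor {F : Type*} [Field F] (W : WeierstrassCurve F)
    (v : AbsoluteValue F ℚ) : Prop where
  a₁ : v W.a₁ ≤ 1
  a₂ : v W.a₂ ≤ 1
  a₃ : v W.a₃ ≤ 1
  a₄ : v W.a₄ ≤ 1
  a₆ : v W.a₆ ≤ 1

namespace WeierstrassCurve.IsIntegralFor

variable {F : Type*} [Field F] {v : AbsoluteValue F ℚ} {W : Affine F}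

section

variable (hW : W.IsIntegralFor v) (hv : v.IsThreeAdic)

include hW hv

/-- The size of the coordinates of a point that is not integral. -/
lemma exists_size {x y : F} (h : W.Equation x y) (hx : 1 < v x) :
    ∃ r : ℚ, 3 ≤ r ∧ v x = r ^ 2 ∧ v y = r ^ 3 := by
  rw [Affine.equation_iff] at h
  have hX : v x < v x ^ 2 := by nlinarith
  have hX' : v x ^ 2 < v x ^ 3 := by nlinarith
  have hx0 : 0 < v x := by linarith
  have hrhs : v (x ^ 3 + W.a₂ * x ^ 2 + W.a₄ * x + W.a₆) = v x ^ 3 := by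
    rw [add_assoc, add_assoc, hv.add_eq, map_pow]
    rw [map_pow]
    refine lt_of_le_of_lt (hv.add_le (v.mul_le_of_le_one hW.a₂ ?_) (hv.add_le (v.mul_le_of_le_one hW.a₄ ?_) ?_)) hX'
    · rw [map_pow]
    · exact hX.le
    · exact hW.a₆.trans (by linarith)
  have hyx : v x < v y := by
    by_contra! hyx
    have : v (y ^ 2 + W.a₁ * x * y + W.a₃ * y) ≤ v x ^ 2 := by
      refine hv.add_le (hv.add_le ?_ ?_) (v.mul_le_of_le_one hW.a₃ (hyx.trans hX.le))
      · rw [map_pow]; exact pow_le_pow_left₀ (v.nonneg y) hyx 2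
      · rw [mul_assoc]
        refine v.mul_le_of_le_one hW.a₁ ?_
        rw [map_mul, sq]; exact mul_le_mul_of_nonneg_left hyx hx0.le
    rw [h, hrhs] at this
    linarith
  have hlhs : v (y ^ 2 + W.a₁ * x * y + W.a₃ * y) = v y ^ 2 := by
    have e : y ^ 2 + W.a₁ * x * y + W.a₃ * y = y * (y + (W.a₁ * x + W.a₃)) := by ring
    rw [e, map_mul, hv.add_eq, sq]
    exact lt_of_le_of_lt (hv.add_le (v.mul_le_of_le_one hW.a₁ le_rfl) (hW.a₃.trans hx.le)) hyx
  have hyy : v y ^ 2 = v x ^ 3 := by rw [← hlhs, h, hrhs]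
  have hr : v (y / x) = v y / v x := map_div₀ v y x
  have hr2 : v x = (v y / v x) ^ 2 := by
    rw [div_pow, hyy]; field_simp
  -- The terms y² and x³ dominate, so r = v(y/x). Absence of ramification improves 1 < r to 3 ≤ r.
  refine ⟨v (y / x), hv.three_le ?_, hr ▸ hr2, ?_⟩
  · rw [hr, one_lt_div hx0]; exact hyx
  · rw [hr, pow_succ, ← hr2]; field_simp

/-- Tripling increases the size of a point that is not integral. -/
lemma exists_three_nsmul [DecidableEq F] {x y : F} (h : W.Nonsingular x y) (hx : 1 < v x) :
    ∃ (x' y' : F) (h' : W.Nonsingular x' y'),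
      3 • Affine.Point.some _ _ h = .some _ _ h' ∧ v x < v x' := by
  -- As in the formal group, doubling does not increase the size beyond r² but tripling does: x(2P)
  -- - x has size r²/3 and y(2P) - y has size r³, so the second chord has slope of size 3r and x(3P)
  -- has size 9r².
  obtain ⟨r, hr, hxr, hyr⟩ := hW.exists_size hv h.1 hx
  have h23 : 3 * r ^ 2 ≤ r ^ 3 := by nlinarith [sq_nonneg r]
  have h34 : 3 * r ^ 3 ≤ r ^ 4 := by nlinarith [pow_nonneg (show 0 ≤ r by linarith) 3]
  have hr2 : 3 * r ≤ r ^ 2 := by nlinarith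
  have hψ : v (2 * y + W.a₁ * x + W.a₃) = r ^ 3 := by
    rw [add_assoc, hv.add_eq, map_mul, hv.two, one_mul, hyr]
    rw [map_mul, hv.two, one_mul, hyr]
    refine lt_of_le_of_lt (hv.add_le (v.mul_le_of_le_one hW.a₁ hxr.le) (hW.a₃.trans ?_)) ?_ <;> nlinarith
  have hψ0 : 2 * y + W.a₁ * x + W.a₃ ≠ 0 := by
    intro h0; rw [h0, map_zero] at hψ; nlinarith
  obtain ⟨l, hl⟩ : ∃ l, l * (2 * y + W.a₁ * x + W.a₃) =
      3 * x ^ 2 + 2 * W.a₂ * x + W.a₄ - W.a₁ * y := ⟨_, div_mul_cancel₀ _ hψ0⟩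
  have hvl : v l ≤ r / 3 := by
    have h1 : v (3 * x ^ 2 + 2 * W.a₂ * x + W.a₄ - W.a₁ * y) ≤ r ^ 4 / 3 := by
      refine hv.sub_le (hv.add_le (hv.add_le ?_ ?_) (hW.a₄.trans ?_)) (v.mul_le_of_le_one hW.a₁ ?_)
      · rw [map_mul, map_pow, hv.three, hxr]; apply le_of_eq; ring
      · rw [mul_assoc]
        exact v.mul_le_of_le_one hv.two.le (v.mul_le_of_le_one hW.a₂ (by rw [hxr]; linarith))
      · nlinarith
      · rw [hyr]; linarith
    rw [← hl, map_mul, hψ] at h1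
    have : 0 < r ^ 3 := by nlinarith
    refine le_of_mul_le_mul_right (h1.trans (le_of_eq ?_)) this
    ring
  obtain ⟨x₂, hx₂⟩ : ∃ x₂, x₂ = l ^ 2 + W.a₁ * l - W.a₂ - x - x := ⟨_, rfl⟩
  obtain ⟨y₂, hy₂⟩ : ∃ y₂, y₂ = -(l * (x₂ - x) + y) - W.a₁ * x₂ - W.a₃ := ⟨_, rfl⟩
  obtain ⟨h₂, h2⟩ := Affine.Point.exists_add_eq_some h h (Or.inr ⟨rfl, rfl, hψ0, hl⟩) hx₂ hy₂
  have hxx : v (x₂ - x) = r ^ 2 / 3 := by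
    have e : x₂ - x = -(3 * x) + (l ^ 2 + W.a₁ * l - W.a₂) := by rw [hx₂]; ring
    have h3 : v (-(3 * x)) = r ^ 2 / 3 := by
      rw [v.map_neg, map_mul, hv.three, hxr]; ring
    rw [e, hv.add_eq, h3]
    rw [h3]
    refine hv.sub_lt (hv.add_lt ?_ ?_) (hW.a₂.trans_lt ?_)
    · rw [map_pow]
      refine (pow_le_pow_left₀ (v.nonneg l) hvl 2).trans_lt ?_
      nlinarith
    · refine (v.mul_le_of_le_one hW.a₁ hvl).trans_lt ?_
      nlinarith
    · nlinarith
  have hvx₂ : v x₂ ≤ r ^ 2 := by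
    have e : x₂ = (x₂ - x) + x := by ring
    rw [e]
    exact hv.add_le (by rw [hxx]; nlinarith) hxr.le
  have hyy : v (y₂ - y) = r ^ 3 := by
    have e : y₂ - y = -(2 * y) - (l * (x₂ - x) + (W.a₁ * x₂ + W.a₃)) := by rw [hy₂]; ring
    have h2 : v (-(2 * y)) = r ^ 3 := by rw [v.map_neg, map_mul, hv.two, hyr, one_mul]
    rw [e, sub_eq_add_neg, hv.add_eq, h2]
    rw [v.map_neg, h2]
    refine hv.add_lt ?_ ((hv.add_le (v.mul_le_of_le_one hW.a₁ hvx₂) (hW.a₃.trans ?_)).trans_lt ?_)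
    · rw [map_mul, hxx]
      have := mul_le_mul_of_nonneg_right hvl (show 0 ≤ r ^ 2 / 3 by positivity)
      nlinarith
    · nlinarith
    · nlinarith
  have hxne : x₂ ≠ x := by
    intro h0; rw [h0, sub_self, map_zero] at hxx; nlinarith
  obtain ⟨m, hm⟩ : ∃ m, m * (x₂ - x) = y₂ - y := ⟨_, div_mul_cancel₀ _ (sub_ne_zero.mpr hxne)⟩
  have hvm : v m = 3 * r := by
    have h1 := congrArg v hm
    rw [map_mul, hxx, hyy] at h1
    have : 0 < r ^ 2 := by nlinarith
    refine mul_right_cancel₀ this.ne' ?_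
    linear_combination 3 * h1
  obtain ⟨h₃, h3⟩ := Affine.Point.exists_add_eq_some h₂ h (Or.inl ⟨hxne, hm⟩) rfl rfl
  refine ⟨_, _, h₃, ?_, ?_⟩
  · rw [← h3, ← h2]; abel
  · have e : m ^ 2 + W.a₁ * m - W.a₂ - x₂ - x = m ^ 2 + (W.a₁ * m - W.a₂ - x₂ - x) := by ring
    have hm2 : v (m ^ 2) = 9 * r ^ 2 := by rw [map_pow, hvm]; ring
    rw [e, hv.add_eq, hm2, hxr]
    · nlinarith
    · rw [hm2]
      refine hv.sub_lt (hv.sub_lt (hv.sub_lt ((v.mul_le_of_le_one hW.a₁ hvm.le).trans_lt ?_)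
        (hW.a₂.trans_lt ?_)) (hvx₂.trans_lt ?_)) (hxr.le.trans_lt ?_) <;> nlinarith

/-- The `x`-coordinate of a torsion point is integral. -/
lemma x_le_one [DecidableEq F] {x y : F} (h : W.Nonsingular x y)
    (hfin : IsOfFinAddOrder (Affine.Point.some _ _ h)) : v x ≤ 1 := by
  by_contra! hx
  rw [← finite_multiples] at hfin
  set M := AddSubmonoid.multiples (Affine.Point.some _ _ h)
  let X : W.Point → F
    | .zero => 0
    | .some x _ _ => x
  let T : Set F := {z | 1 < v z ∧ ∃ (t : F) (h' : W.Nonsingular z t), Affine.Point.some _ _ h' ∈ M}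
  have hT : T.Finite := by
    refine (hfin.image X).subset ?_
    rintro r ⟨-, z, h', hr⟩
    exact ⟨_, hr, rfl⟩
  obtain ⟨r, ⟨hr, z, h', hz⟩, hmax⟩ := Set.exists_max_image T v hT
    ⟨x, hx, y, h, AddSubmonoid.mem_multiples _⟩
  obtain ⟨r', z', h'', hadd, hlt⟩ := hW.exists_three_nsmul hv h' hr
  exact (hmax r' ⟨hr.trans hlt, z', h'', hadd ▸ nsmul_mem hz 3⟩).not_gt hlt

lemma y_le_one {x y : F} (h : W.Equation x y) (hx : v x ≤ 1) : v y ≤ 1 := by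
  by_contra! hy
  rw [Affine.equation_iff] at h
  have e : y * (y + (W.a₁ * x + W.a₃)) = x ^ 3 + W.a₂ * x ^ 2 + W.a₄ * x + W.a₆ := by
    rw [← h]; ring
  have h1 : v (y * (y + (W.a₁ * x + W.a₃))) = v y * v y := by
    rw [map_mul, hv.add_eq]
    exact (hv.add_le (v.mul_le_of_le_one hW.a₁ hx) hW.a₃).trans_lt hy
  have hxn (n : ℕ) : v (x ^ n) ≤ 1 := by rw [map_pow]; exact pow_le_one₀ (v.nonneg x) hx
  have h2 : v (x ^ 3 + W.a₂ * x ^ 2 + W.a₄ * x + W.a₆) ≤ 1 :=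
    hv.add_le (hv.add_le (hv.add_le (hxn 3) (v.mul_le_of_le_one hW.a₂ (hxn 2))) (v.mul_le_of_le_one hW.a₄ hx)) hW.a₆
  rw [← e, h1] at h2
  nlinarith

/-- Reduction is injective on torsion points. -/
lemma eq_of_sub_lt_one [DecidableEq F] {x y x' y' : F} (h : W.Nonsingular x y)
    (h' : W.Nonsingular x' y') (hfin : IsOfFinAddOrder (Affine.Point.some _ _ h))
    (hfin' : IsOfFinAddOrder (Affine.Point.some _ _ h')) (hxx : v (x - x') < 1)
    (hyy : v (y - y') < 1) (hψ : v (2 * y + W.a₁ * x + W.a₃) = 1) :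
    Affine.Point.some _ _ h = .some _ _ h' := by
  -- The reduced points agree and are not 2-torsion, so y stays away from the ordinate of -P'. If x
  -- ≠ x', the chord for P - P' then has slope of size above 1 and the torsion point P - P' has a
  -- nonintegral abscissa.
  have hd : v (y - W.negY x' y') = 1 := by
    have e : y - W.negY x' y' =
        (2 * y + W.a₁ * x + W.a₃) + (-(y - y') - W.a₁ * (x - x')) := by
      rw [Affine.negY]; ring
    rw [e, hv.add_eq, hψ]
    rw [hψ]
    refine hv.sub_lt (by rwa [v.map_neg]) ?_
    rw [map_mul]
    exact (mul_le_of_le_one_left (v.nonneg _) hW.a₁).trans_lt hxx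
  have hx : x = x' := by
    by_contra hne
    have hsub : x - x' ≠ 0 := sub_ne_zero.mpr hne
    obtain ⟨l, hl⟩ : ∃ l, l * (x - x') = y - W.negY x' y' := ⟨_, div_mul_cancel₀ _ hsub⟩
    obtain ⟨h₃, h3⟩ := Affine.Point.exists_add_eq_some h ((Affine.nonsingular_neg ..).mpr h')
      (Or.inl ⟨hne, hl⟩) rfl rfl
    have hl1 : 1 < v l := by
      have h1 := congrArg v hl
      rw [map_mul, hd] at h1
      have h2 := v.pos hsub
      have h3 := v.nonneg l
      by_contra! h4
      nlinarith
    have hfin3 := hfin.add hfin'.neg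
    rw [Affine.Point.neg_some, h3] at hfin3
    have h4 := hW.x_le_one hv h₃ hfin3
    have e : l ^ 2 + W.a₁ * l - W.a₂ - x - x' = l ^ 2 + (W.a₁ * l - W.a₂ - x - x') := by ring
    rw [e, hv.add_eq, map_pow] at h4
    · nlinarith
    · have hlt : v l < v (l ^ 2) := by rw [map_pow]; nlinarith
      exact (hv.sub_le (hv.sub_le (hv.sub_le (v.mul_le_of_le_one hW.a₁ le_rfl) (hW.a₂.trans hl1.le))
        ((hW.x_le_one hv h hfin).trans hl1.le)) ((hW.x_le_one hv h' hfin').trans hl1.le)).trans_lt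
        hlt
  subst hx
  have hne : y ≠ W.negY x y' := by
    intro h0; rw [← h0, sub_self, map_zero] at hd; norm_num at hd
  obtain rfl := Affine.Y_eq_of_Y_ne h.1 h'.1 rfl hne
  rfl

end

end WeierstrassCurve.IsIntegralFor

/-! ### The 3-adic absolute value and reduction on ℚ(√-7) -/

lemma padicNorm_mul_den (q : ℚ) : padicNorm 3 q * padicNorm 3 q.den = padicNorm 3 q.num := by
  rw [← padicNorm.mul, Rat.mul_den_eq_num]

lemma den_cast_ne_zero {q : ℚ} (hq : padicNorm 3 q ≤ 1) : (q.den : ZMod 3) ≠ 0 := by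
  rw [Ne, ZMod.natCast_eq_zero_iff]
  intro hd
  have hn : padicNorm 3 q.num = 1 := by
    rw [padicNorm.int_eq_one_iff]
    intro hn
    have := Nat.dvd_gcd (Int.natCast_dvd.mp hn) hd
    rw [q.reduced] at this
    omega
  have h1 := padicNorm_mul_den q
  rw [hn] at h1
  have h2 := (padicNorm.nat_lt_one_iff (p := 3) q.den).mpr hd
  nlinarith [padicNorm.nonneg (p := 3) q.den]

lemma padicNorm_lt_one_iff {q : ℚ} (hq : padicNorm 3 q ≤ 1) :
    padicNorm 3 q < 1 ↔ (q : ZMod 3) = 0 := by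
  have hd := den_cast_ne_zero hq
  have h1 : padicNorm 3 q.den = 1 := by
    rw [padicNorm.nat_eq_one_iff, ← ZMod.natCast_eq_zero_iff]; exact hd
  have h2 := padicNorm_mul_den q
  rw [h1, mul_one] at h2
  rw [h2, padicNorm.int_lt_one_iff, Rat.cast_def, div_eq_zero_iff, or_iff_left hd]
  exact (ZMod.intCast_zmod_eq_zero_iff_dvd _ 3).symm

/-- Since -7 is not a square modulo 3, no cancellation occurs between a² and 7b². This inertness of
3 makes the maximum norm on ℚ(√-7) multiplicative. -/
lemma padicNorm_sq_add_seven_mul_sq (a b : ℚ) :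
    padicNorm 3 (a ^ 2 + 7 * b ^ 2) = max (padicNorm 3 a) (padicNorm 3 b) ^ 2 := by
  have hp (q : ℚ) : padicNorm 3 (q ^ 2) = padicNorm 3 q ^ 2 := by rw [sq, padicNorm.mul, sq]
  have h7 : padicNorm 3 7 = 1 := by
    have := (padicNorm.nat_eq_one_iff (p := 3) 7).mpr (by norm_num)
    exact_mod_cast this
  have hB : padicNorm 3 (7 * b ^ 2) = padicNorm 3 b ^ 2 := by rw [padicNorm.mul, h7, one_mul, hp]
  have ha0 := padicNorm.nonneg (p := 3) a
  have hb0 := padicNorm.nonneg (p := 3) b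
  by_cases h : padicNorm 3 a = padicNorm 3 b
  · rcases eq_or_ne b 0 with rfl | hb
    · simp [hp, max_eq_left ha0]
    obtain ⟨u, rfl⟩ : ∃ u, a = u * b := ⟨a / b, by field_simp⟩
    have hbn := padicNorm.nonzero (p := 3) hb
    have hu : padicNorm 3 u = 1 := by
      rw [padicNorm.mul] at h
      exact (mul_eq_right₀ hbn).mp h
    have hu2 : padicNorm 3 (u ^ 2) ≤ 1 := by rw [hp, hu]; norm_num
    have e : (u * b) ^ 2 + 7 * b ^ 2 = (u ^ 2 + 7) * b ^ 2 := by ring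
    have h1 : padicNorm 3 (u ^ 2 + 7) ≤ 1 :=
      padicNorm.nonarchimedean.trans (max_le hu2 h7.le)
    have h2 : padicNorm 3 (u ^ 2 + 7) = 1 := by
      refine h1.eq_of_not_lt fun hlt => ?_
      rw [padicNorm_lt_one_iff h1, Rat.cast_add_of_ne_zero (den_cast_ne_zero hu2)
        (den_cast_ne_zero h7.le), sq, Rat.cast_mul_of_ne_zero (den_cast_ne_zero hu.le)
        (den_cast_ne_zero hu.le), Rat.cast_ofNat] at hlt
      revert hlt
      generalize (u : ZMod 3) = w
      revert w
      decide
    rw [e, padicNorm.mul, h2, one_mul, hp, h, max_self]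
  · rw [padicNorm.add_eq_max_of_ne, hB, hp]
    · rcases le_total (padicNorm 3 a) (padicNorm 3 b) with hab | hab
      · rw [max_eq_right hab, max_eq_right (pow_le_pow_left₀ ha0 hab 2)]
      · rw [max_eq_left hab, max_eq_left (pow_le_pow_left₀ hb0 hab 2)]
    · rw [hp, hB]
      exact fun h' => h ((pow_left_inj₀ ha0 hb0 two_ne_zero).mp h')

namespace QuadField

/-- The `3`-adic absolute value of `ℚ(√-7)`, in which `3` is inert. -/
def threeAdic : AbsoluteValue (QuadField (-7)) ℚ where
  toFun z := max (padicNorm 3 z.re) (padicNorm 3 z.im)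
  map_mul' z w := by
    have key (z : QuadField (-7)) : padicNorm 3 (QuadraticAlgebra.norm z) =
        max (padicNorm 3 z.re) (padicNorm 3 z.im) ^ 2 := by
      rw [← padicNorm_sq_add_seven_mul_sq, QuadraticAlgebra.norm_def]
      congr 1
      ring
    have hnn (z : QuadField (-7)) : 0 ≤ max (padicNorm 3 z.re) (padicNorm 3 z.im) :=
      le_max_of_le_left (padicNorm.nonneg _)
    refine (pow_left_inj₀ (hnn _) (mul_nonneg (hnn z) (hnn w)) two_ne_zero).mp ?_
    rw [mul_pow, ← key, ← key, ← key, map_mul, padicNorm.mul]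
  nonneg' z := le_max_of_le_left (padicNorm.nonneg _)
  eq_zero' z := by
    constructor
    · intro h
      have h1 := le_antisymm ((le_max_left _ _).trans h.le) (padicNorm.nonneg z.re)
      have h2 := le_antisymm ((le_max_right _ _).trans h.le) (padicNorm.nonneg z.im)
      ext
      · exact padicNorm.zero_of_padicNorm_eq_zero h1
      · exact padicNorm.zero_of_padicNorm_eq_zero h2
    · rintro rfl
      simp
  add_le' z w := by
    refine max_le ?_ ?_
    · exact (padicNorm.triangle_ineq z.re w.re).trans
        (add_le_add (le_max_left _ _) (le_max_left _ _))
    · exact (padicNorm.triangle_ineq z.im w.im).trans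
        (add_le_add (le_max_right _ _) (le_max_right _ _))

lemma threeAdic_apply (z : QuadField (-7)) :
    threeAdic z = max (padicNorm 3 z.re) (padicNorm 3 z.im) := rfl

lemma threeAdic_natCast (n : ℕ) : threeAdic (n : QuadField (-7)) = padicNorm 3 n := by
  rw [threeAdic_apply, QuadraticAlgebra.re_natCast, QuadraticAlgebra.im_natCast, padicNorm.zero,
    max_eq_left (padicNorm.nonneg _)]

lemma isThreeAdic : threeAdic.IsThreeAdic where
  add_le' z w := by
    simp only [threeAdic_apply, QuadraticAlgebra.re_add, QuadraticAlgebra.im_add]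
    refine max_le ?_ ?_
    · exact padicNorm.nonarchimedean.trans (max_le_max (le_max_left _ _) (le_max_left _ _))
    · exact padicNorm.nonarchimedean.trans (max_le_max (le_max_right _ _) (le_max_right _ _))
  two := by
    have := threeAdic_natCast 2
    rw [(padicNorm.nat_eq_one_iff (p := 3) 2).mpr (by norm_num)] at this
    exact_mod_cast this
  three := by
    have := threeAdic_natCast 3
    rw [padicNorm.padicNorm_p (by norm_num)] at this
    rw [one_div]
    exact_mod_cast this
  three_le {z} hz := by
    have key {q : ℚ} (hq : 1 < padicNorm 3 q) : 3 ≤ padicNorm 3 q := by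
      have hq0 : q ≠ 0 := by rintro rfl; simp at hq; linarith
      obtain ⟨n, hn⟩ := padicNorm.values_discrete (p := 3) hq0
      rw [hn] at hq ⊢
      have h1 : 0 < -n := (one_lt_zpow_iff_right₀ (by norm_num)).mp hq
      calc (3 : ℚ) = ((3 : ℕ) : ℚ) ^ (1 : ℤ) := by norm_num
        _ ≤ _ := zpow_le_zpow_right₀ (by norm_num) (by omega)
    rw [threeAdic_apply] at hz ⊢
    rcases lt_max_iff.mp hz with h | h
    · exact le_max_of_le_left (key h)
    · exact le_max_of_le_right (key h)

/-- The residue field of `ℚ(√-7)` at `3`. -/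
abbrev ResidueThree : Type := QuadraticAlgebra (ZMod 3) (-7) 0

/-- Reduction modulo `3`, meaningful on integral elements. -/
def reduce (z : QuadField (-7)) : ResidueThree := ⟨z.re, z.im⟩

/-- The subring of elements of `ℚ(√-7)` that are integral at `3`. -/
def integersThree : Subring (QuadField (-7)) where
  carrier := {z | threeAdic z ≤ 1}
  mul_mem' ha hb := AbsoluteValue.mul_le_of_le_one ha hb
  one_mem' := threeAdic.map_one.le
  add_mem' ha hb := isThreeAdic.add_le ha hb
  zero_mem' := by simp
  neg_mem' ha := by simpa using ha

lemma reduce_add {z w : QuadField (-7)} (hz : threeAdic z ≤ 1) (hw : threeAdic w ≤ 1) :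
    reduce (z + w) = reduce z + reduce w := by
  obtain ⟨hz1, hz2⟩ := max_le_iff.mp hz
  obtain ⟨hw1, hw2⟩ := max_le_iff.mp hw
  ext
  · exact Rat.cast_add_of_ne_zero (den_cast_ne_zero hz1) (den_cast_ne_zero hw1)
  · exact Rat.cast_add_of_ne_zero (den_cast_ne_zero hz2) (den_cast_ne_zero hw2)

lemma reduce_mul {z w : QuadField (-7)} (hz : threeAdic z ≤ 1) (hw : threeAdic w ≤ 1) :
    reduce (z * w) = reduce z * reduce w := by
  obtain ⟨hz1, hz2⟩ := max_le_iff.mp hz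
  obtain ⟨hw1, hw2⟩ := max_le_iff.mp hw
  have hmul {a b : ℚ} (ha : padicNorm 3 a ≤ 1) (hb : padicNorm 3 b ≤ 1) :
      padicNorm 3 (a * b) ≤ 1 ∧ ((a * b : ℚ) : ZMod 3) = a * b :=
    ⟨by rw [padicNorm.mul]; exact mul_le_one₀ ha (padicNorm.nonneg _) hb,
      Rat.cast_mul_of_ne_zero (den_cast_ne_zero ha) (den_cast_ne_zero hb)⟩
  have hadd {a b : ℚ} (ha : padicNorm 3 a ≤ 1) (hb : padicNorm 3 b ≤ 1) :
      ((a + b : ℚ) : ZMod 3) = a + b :=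
    Rat.cast_add_of_ne_zero (den_cast_ne_zero ha) (den_cast_ne_zero hb)
  have h7 : padicNorm 3 (-7 : ℚ) ≤ 1 := by
    have := padicNorm.of_int (p := 3) (-7)
    exact_mod_cast this
  ext
  · simp only [reduce, QuadraticAlgebra.re_mul]
    rw [hadd (hmul hz1 hw1).1 (hmul (hmul h7 hz2).1 hw2).1, (hmul hz1 hw1).2,
      (hmul (hmul h7 hz2).1 hw2).2, (hmul h7 hz2).2, Rat.cast_neg, Rat.cast_ofNat]
  · simp only [reduce, QuadraticAlgebra.im_mul, zero_mul, add_zero]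
    rw [hadd (hmul hz1 hw2).1 (hmul hz2 hw1).1, (hmul hz1 hw2).2, (hmul hz2 hw1).2]

/-- Reduction modulo `3` as a ring homomorphism. -/
def reduceHom : integersThree →+* ResidueThree where
  toFun z := reduce z
  map_one' := QuadraticAlgebra.ext Rat.cast_one Rat.cast_zero
  map_mul' z w := reduce_mul z.2 w.2
  map_zero' := QuadraticAlgebra.ext Rat.cast_zero Rat.cast_zero
  map_add' z w := reduce_add z.2 w.2

lemma threeAdic_lt_one_iff (z : integersThree) :
    threeAdic (z : QuadField (-7)) < 1 ↔ reduceHom z = 0 := by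
  obtain ⟨z, hz⟩ := z
  obtain ⟨hz1, hz2⟩ := max_le_iff.mp (show threeAdic z ≤ 1 from hz)
  rw [threeAdic_apply, max_lt_iff, padicNorm_lt_one_iff hz1, padicNorm_lt_one_iff hz2]
  exact ⟨fun h => QuadraticAlgebra.ext h.1 h.2, fun h =>
    ⟨congrArg QuadraticAlgebra.re h, congrArg QuadraticAlgebra.im h⟩⟩

end QuadField

/-! ### Reduction of the explicit curve modulo 3 -/

open WeierstrassCurve QuadField

/-- The affine points of the reduction modulo `3` of the explicit curve, in coordinates. -/
def reducedPoints : Finset ((ZMod 3 × ZMod 3) × (ZMod 3 × ZMod 3)) :=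
  Finset.univ.filter fun P =>
    let X : ResidueThree := ⟨P.1.1, P.1.2⟩
    let Y : ResidueThree := ⟨P.2.1, P.2.2⟩
    let S : ResidueThree := ⟨0, 1⟩
    Y * Y + 2 * X * Y + S * Y = X * X * X + (2 * S + 1) * X * X

/-- With the point at infinity this makes 11, so reduction leaves no room for further torsion. -/
lemma card_reducedPoints : reducedPoints.card = 10 := by decide

/-- Nonvanishing of the Y-derivative: every reduced affine point is smooth and none is 2-torsion, as
injectivity of reduction requires. -/
lemma reduced_nonsingular : ∀ P ∈ reducedPoints,
    2 * (⟨P.2.1, P.2.2⟩ : ResidueThree) + 2 * ⟨P.1.1, P.1.2⟩ + ⟨0, 1⟩ ≠ 0 := by decide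

namespace QuadField

lemma threeAdic_intCast_le (n : ℤ) : threeAdic (n : QuadField (-7)) ≤ 1 := by
  rw [threeAdic_apply, QuadraticAlgebra.re_intCast, QuadraticAlgebra.im_intCast, padicNorm.zero]
  exact max_le (padicNorm.of_int n) zero_le_one

lemma threeAdic_sqrtGen_le : threeAdic (sqrtGen (-7)) ≤ 1 := by
  rw [threeAdic_apply]
  simp [sqrtGen]

lemma threeAdic_le_one (m n : ℤ) (k : ℕ) :
    threeAdic ((m + n * sqrtGen (-7)) / 2 ^ k) ≤ 1 := by
  rw [map_div₀, map_pow, isThreeAdic.two, one_pow, div_one]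
  exact isThreeAdic.add_le (threeAdic_intCast_le m)
    (AbsoluteValue.mul_le_of_le_one (threeAdic_intCast_le n) threeAdic_sqrtGen_le)

/-- `√-7` as an element that is integral at `3`. -/
def sqrtInt : integersThree := ⟨sqrtGen (-7), threeAdic_sqrtGen_le⟩

lemma threeAdic_coe_le (z : integersThree) : threeAdic (z : QuadField (-7)) ≤ 1 := z.2

lemma coe_ofNat_integersThree (n : ℕ) [n.AtLeastTwo] :
    ((ofNat(n) : integersThree) : QuadField (-7)) = ofNat(n) := map_ofNat integersThree.subtype n

lemma threeAdic_sub_lt_one {x y : QuadField (-7)} (hx : threeAdic x ≤ 1) (hy : threeAdic y ≤ 1)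
    (h : reduce x = reduce y) : threeAdic (x - y) < 1 := by
  obtain ⟨x, rfl⟩ : ∃ z : integersThree, z = x := ⟨⟨x, hx⟩, rfl⟩
  obtain ⟨y, rfl⟩ : ∃ z : integersThree, z = y := ⟨⟨y, hy⟩, rfl⟩
  rw [← AddSubgroupClass.coe_sub, threeAdic_lt_one_iff, map_sub, sub_eq_zero]
  exact h

lemma reduceHom_sqrtInt : reduceHom sqrtInt = ⟨0, 1⟩ :=
  QuadraticAlgebra.ext Rat.cast_zero Rat.cast_one

end QuadField

/-- The denominators are powers of 2, units at 3; the decomposition exhibits the coefficients modulo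
3. -/
lemma explicitCurve11_coeff : ∃ c₁ c₂ c₃ : integersThree,
    explicitCurve11.a₁ = (2 + 3 * c₁ : integersThree) ∧
    explicitCurve11.a₂ = (2 * sqrtInt + 1 + 3 * c₂ : integersThree) ∧
    explicitCurve11.a₃ = (sqrtInt + 3 * c₃ : integersThree) := by
  refine ⟨⟨_, threeAdic_le_one (-57) 11 7⟩, ⟨_, threeAdic_le_one (-1457) (-2701) 12⟩,
    ⟨_, threeAdic_le_one (-333) (-5433) 14⟩, ?_, ?_, ?_⟩
  · push_cast
    simp only [explicitCurve11, coe_ofNat_integersThree]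
    ring
  · push_cast
    simp only [explicitCurve11, sqrtInt, coe_ofNat_integersThree]
    ring
  · push_cast
    simp only [explicitCurve11, sqrtInt, coe_ofNat_integersThree]
    ring

lemma isIntegralFor_explicitCurve11 : explicitCurve11.IsIntegralFor threeAdic := by
  obtain ⟨c₁, c₂, c₃, h₁, h₂, h₃⟩ := explicitCurve11_coeff
  exact ⟨h₁ ▸ threeAdic_coe_le _, h₂ ▸ threeAdic_coe_le _, h₃ ▸ threeAdic_coe_le _, by simp [explicitCurve11],
    by simp [explicitCurve11]⟩

/-- The coordinates of a pair of elements of the residue field. -/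
def residueCoords (X Y : ResidueThree) : (ZMod 3 × ZMod 3) × (ZMod 3 × ZMod 3) :=
  ((X.re, X.im), (Y.re, Y.im))

lemma reduction_of_equation {x y : QuadField (-7)} (hx : threeAdic x ≤ 1) (hy : threeAdic y ≤ 1)
    (h : explicitCurve11.toAffine.Equation x y) :
    residueCoords (reduce x) (reduce y) ∈ reducedPoints ∧
      threeAdic (2 * y + explicitCurve11.a₁ * x + explicitCurve11.a₃) = 1 := by
  obtain ⟨x, rfl⟩ : ∃ z : integersThree, z = x := ⟨⟨x, hx⟩, rfl⟩
  obtain ⟨y, rfl⟩ : ∃ z : integersThree, z = y := ⟨⟨y, hy⟩, rfl⟩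
  change residueCoords (reduceHom x) (reduceHom y) ∈ reducedPoints ∧ _
  obtain ⟨c₁, c₂, c₃, h₁, h₂, h₃⟩ := explicitCurve11_coeff
  have h30 : (3 : ResidueThree) = 0 := by decide
  rw [Affine.equation_iff, h₁, h₂, h₃] at h
  have h4 : explicitCurve11.a₄ = 0 := rfl
  have h6 : explicitCurve11.a₆ = 0 := rfl
  rw [h4, h6, zero_mul, add_zero, add_zero] at h
  have hR : y ^ 2 + (2 + 3 * c₁) * x * y + (sqrtInt + 3 * c₃) * y =
      x ^ 3 + (2 * sqrtInt + 1 + 3 * c₂) * x ^ 2 := Subtype.ext (by push_cast at h ⊢; exact h)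
  have hk := congrArg reduceHom hR
  simp only [map_add, map_mul, map_pow, map_ofNat, map_one, h30, zero_mul, add_zero,
    reduceHom_sqrtInt] at hk
  have hmem : residueCoords (reduceHom x) (reduceHom y) ∈ reducedPoints := by
    refine Finset.mem_filter.mpr ⟨Finset.mem_univ _, ?_⟩
    simp only [residueCoords, QuadraticAlgebra.mk_eta]
    linear_combination hk
  refine ⟨hmem, ?_⟩
  have hψ : 2 * (y : QuadField (-7)) + explicitCurve11.a₁ * x + explicitCurve11.a₃ =
      (2 * y + (2 + 3 * c₁) * x + (sqrtInt + 3 * c₃) : integersThree) := by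
    rw [h₁, h₃]; push_cast; rfl
  rw [hψ]
  refine le_antisymm (threeAdic_coe_le _) (not_lt.mp fun hlt => ?_)
  rw [threeAdic_lt_one_iff] at hlt
  simp only [map_add, map_mul, map_ofNat, h30, zero_mul, add_zero, reduceHom_sqrtInt] at hlt
  exact reduced_nonsingular _ hmem hlt

/-- The explicit curve has at most `11` torsion points over `ℚ(√-7)`. -/
lemma card_torsion_explicitCurve11_le :
    Finite (AddCommGroup.torsion explicitCurve11.toAffine.Point) ∧
      Nat.card (AddCommGroup.torsion explicitCurve11.toAffine.Point) ≤ 11 := by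
  have hW := isIntegralFor_explicitCurve11
  have hint {x y : QuadField (-7)} {h : explicitCurve11.toAffine.Nonsingular x y}
      (hP : Affine.Point.some _ _ h ∈ AddCommGroup.torsion explicitCurve11.toAffine.Point) :
      threeAdic x ≤ 1 ∧ threeAdic y ≤ 1 :=
    have hx := hW.x_le_one isThreeAdic h hP
    ⟨hx, hW.y_le_one isThreeAdic h.1 hx⟩
  let f : explicitCurve11.toAffine.Point → Option ((ZMod 3 × ZMod 3) × (ZMod 3 × ZMod 3))
    | .zero => none
    | .some x y _ => some (residueCoords (reduce x) (reduce y))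
  have hmem (P : AddCommGroup.torsion explicitCurve11.toAffine.Point) :
      f P ∈ Finset.insertNone reducedPoints := by
    obtain ⟨_ | ⟨x, y, h⟩, hP⟩ := P
    · exact Finset.none_mem_insertNone
    · rw [Finset.mem_insertNone]
      intro c hc
      obtain rfl := Option.some.inj hc
      exact (reduction_of_equation (hint hP).1 (hint hP).2 h.1).1
  let g : AddCommGroup.torsion explicitCurve11.toAffine.Point → Finset.insertNone reducedPoints :=
    fun P => ⟨f P, hmem P⟩
  have hg : Function.Injective g := by
    rintro ⟨P, hP⟩ ⟨Q, hQ⟩ hPQ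
    replace hPQ : f P = f Q := congrArg Subtype.val hPQ
    refine Subtype.ext (?_ : P = Q)
    rcases P with _ | ⟨x, y, h⟩ <;> rcases Q with _ | ⟨x', y', h'⟩
    · rfl
    · simp [f] at hPQ
    · simp [f] at hPQ
    · simp only [f, residueCoords, Option.some.injEq, Prod.mk.injEq] at hPQ
      obtain ⟨⟨hx1, hx2⟩, hy1, hy2⟩ := hPQ
      exact hW.eq_of_sub_lt_one isThreeAdic h h' hP hQ
        (threeAdic_sub_lt_one (hint hP).1 (hint hQ).1 (QuadraticAlgebra.ext hx1 hx2))
        (threeAdic_sub_lt_one (hint hP).2 (hint hQ).2 (QuadraticAlgebra.ext hy1 hy2))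
        (reduction_of_equation (hint hP).1 (hint hP).2 h.1).2
  refine ⟨Finite.of_injective g hg, (Nat.card_le_card_of_injective g hg).trans ?_⟩
  rw [Nat.card_eq_fintype_card, Fintype.card_coe, Finset.card_insertNone, card_reducedPoints]

lemma sqrtGen_neg_seven_sq : sqrtGen (-7) ^ 2 = (-7 : QuadField (-7)) := by
  rw [sqrtGen_sq]; rfl

lemma isElliptic_explicitCurve11 : explicitCurve11.IsElliptic :=
  isElliptic_of_sqrt_neg_seven sqrtGen_neg_seven_sq rfl rfl rfl rfl rfl

lemma exists_addOrderOf_explicitCurve11 : ∃ h0 : explicitCurve11.toAffine.Nonsingular 0 0,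
    addOrderOf (Affine.Point.some 0 0 h0) = 11 := by
  have := isElliptic_explicitCurve11
  have h0 : explicitCurve11.toAffine.Nonsingular 0 0 := by
    rw [← Affine.equation_iff_nonsingular, Affine.equation_iff]
    simp [explicitCurve11]
  exact ⟨h0, addOrderOf_of_sqrt_neg_seven sqrtGen_neg_seven_sq rfl rfl rfl rfl rfl h0⟩

/-- `ℤ/11ℤ` is the torsion group of the explicit curve over `ℚ(√-7)`. -/
lemma appearsAsTorsion_neg_seven : AppearsAsTorsion (ZMod 11) (QuadField (-7)) := by
  obtain ⟨h0, hord⟩ := exists_addOrderOf_explicitCurve11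
  obtain ⟨hfin, hcard⟩ := card_torsion_explicitCurve11_le
  refine ⟨explicitCurve11, isElliptic_explicitCurve11, ?_⟩
  have hP : Affine.Point.some 0 0 h0 ∈ AddCommGroup.torsion explicitCurve11.toAffine.Point :=
    addOrderOf_pos_iff.mp (by rw [hord]; norm_num)
  have hdvd : 11 ∣ Nat.card (AddCommGroup.torsion explicitCurve11.toAffine.Point) := by
    rw [← hord, ← AddSubgroup.addOrderOf_mk _ hP]
    exact addOrderOf_dvd_natCard _
  have h11 : Nat.card (AddCommGroup.torsion explicitCurve11.toAffine.Point) = 11 :=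
    le_antisymm hcard (Nat.le_of_dvd Nat.card_pos hdvd)
  have : Fact (Nat.Prime 11) := ⟨by norm_num⟩
  have hc := isAddCyclic_of_prime_card h11
  have e := zmodAddCyclicAddEquiv hc
  rw [h11] at e
  exact ⟨e.symm⟩

/-! ### Excluding the smaller fields and conclusion -/

lemma exists_point_of_appearsAsTorsion {K : Type*} [Field K] [DecidableEq K]
    (h : AppearsAsTorsion (ZMod 11) K) : ∃ x y : K, y ^ 2 - y = x ^ 3 - x ^ 2 ∧ x ≠ 0 ∧ x ≠ 1 := by
  obtain ⟨E, hE, ⟨e⟩⟩ := h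
  refine exists_point_of_order_eleven E (e.symm 1 : E.toAffine.Point) ?_
  rw [AddSubgroup.addOrderOf_coe, AddEquiv.addOrderOf_eq, ZMod.addOrderOf_one]

lemma not_appearsAsTorsion_of_ringEquiv {K : Type*} [Field K] [DecidableEq K] {d : ℚ}
    [Fact (∀ r : ℚ, r ^ 2 ≠ d + 0 * r)]
    (hd : ∀ x y : QuadField d, y ^ 2 - y = x ^ 3 - x ^ 2 → (x = 0 ∨ x = 1) ∧ (y = 0 ∨ y = 1))
    (hK : Nonempty (K ≃+* QuadField d)) : ¬ AppearsAsTorsion (ZMod 11) K := by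
  intro h
  obtain ⟨f⟩ := hK
  obtain ⟨x, y, hxy, h0, h1⟩ := exists_point_of_appearsAsTorsion h
  rcases (hd (f x) (f y) (by simpa only [map_sub, map_pow] using congrArg f hxy)).1 with h | h
  · exact h0 ((map_eq_zero f).mp h)
  · exact h1 ((map_eq_one_iff f f.injective).mp h)

/-- A quadratic field of absolute discriminant at most `7` over which `ℤ/11ℤ` appears as a torsion
group is `ℚ(√-7)`. -/
lemma eq_of_abs_discr_le {K : Type*} [Field K] [NumberField K] [DecidableEq K]
    (hK : IsQuadraticField K) (h : AppearsAsTorsion (ZMod 11) K) (hd : |NumberField.discr K| ≤ 7) :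
    NumberField.discr K = -7 ∧ Nonempty (K ≃+* QuadField (-7)) := by
  rcases hK.exists_sq_eq hd with ⟨s, hs⟩ | ⟨s, hs⟩ | ⟨s, hs⟩ | ⟨hD, s, hs⟩
  · exact absurd h (not_appearsAsTorsion_of_ringEquiv (fun _ _ => points_neg_one)
      (hK.nonempty_ringEquiv (s := s) (by rw [hs]; norm_num)))
  · exact absurd h (not_appearsAsTorsion_of_ringEquiv (fun _ _ => points_neg_three)
      (hK.nonempty_ringEquiv (s := s) (by rw [hs]; norm_num)))
  · exact absurd h (not_appearsAsTorsion_of_ringEquiv (fun _ _ => points_five)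
      (hK.nonempty_ringEquiv (s := s) (by rw [hs]; norm_num)))
  · exact ⟨hD, hK.nonempty_ringEquiv (s := s) (by rw [hs]; norm_num)⟩

lemma exists_infinite_order_point : ∃ (x y : QuadField (-7))
    (h : (modularX1_11 (QuadField (-7))).toAffine.Nonsingular x y),
      ¬ IsOfFinAddOrder (Affine.Point.some x y h) ∧ ¬ IsCusp11 (Affine.Point.some x y h) ∧
      ∃ C : VariableChange (QuadField (-7)), C.r = 0 ∧ C.t = 0 ∧
        C • universalCurve11 x y = explicitCurve11 := by
  obtain ⟨h, hinf⟩ := exists_infinite_order_of_sqrt_neg_seven sqrtGen_neg_seven_sq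
  obtain ⟨C, hr, ht, hC⟩ := exists_variableChange_universalCurve11 sqrtGen_neg_seven_sq
  refine ⟨_, _, h, hinf, ?_, C, hr, ht, hC⟩
  rintro (hx | hΔ)
  · exact one_ne_zero (α := QuadField (-7)) (by
      linear_combination (5 - sqrtGen (-7)) / 4 * hx + sqrtGen_neg_seven_sq / 32)
  -- A change of variables scales Δ by a unit, so a cusp would make the explicit curve singular.
  · have h1 := variableChange_Δ (W := universalCurve11 ((5 + sqrtGen (-7)) / 8)
      ((11 - sqrtGen (-7)) / 16)) C
    rw [hΔ, mul_zero, hC] at h1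
    exact isElliptic_explicitCurve11.isUnit.ne_zero h1

theorem theorem2 :
    -- `ℚ(√-7)` is the quadratic field of smallest `|Δ|` over which `ℤ/11ℤ` appears
    (IsQuadraticField (QuadField (-7)) ∧
      AppearsAsTorsion (ZMod 11) (QuadField (-7)) ∧
      ∀ (K : Type*) [Field K] [NumberField K] [DecidableEq K],
        IsQuadraticField K → AppearsAsTorsion (ZMod 11) K →
          |NumberField.discr (QuadField (-7))| ≤ |NumberField.discr K| ∧
          (|NumberField.discr K| = |NumberField.discr (QuadField (-7))| →
            Nonempty (K ≃+* QuadField (-7)))) ∧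
    -- `X₁(11)` has rank `0` and torsion `ℤ/5ℤ` made of cusps over `ℚ(i)`, `ℚ(√-3)`, `ℚ(√5)`
    (RankZeroCuspidalTorsion11 (QuadField (-1)) ∧
      RankZeroCuspidalTorsion11 (QuadField (-3)) ∧
      RankZeroCuspidalTorsion11 (QuadField 5)) ∧
    -- a point of infinite order over `ℚ(√-7)` gives the explicit curve, with `(0, 0)` of order `11`
    (∃ (x y : QuadField (-7)) (h : (modularX1_11 (QuadField (-7))).toAffine.Nonsingular x y),
      ¬ IsOfFinAddOrder (WeierstrassCurve.Affine.Point.some x y h) ∧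
      ¬ IsCusp11 (WeierstrassCurve.Affine.Point.some x y h) ∧
      ∃ C : WeierstrassCurve.VariableChange (QuadField (-7)), C.r = 0 ∧ C.t = 0 ∧
        C • universalCurve11 x y = explicitCurve11) ∧
    explicitCurve11.IsElliptic ∧
    ∃ h0 : explicitCurve11.toAffine.Nonsingular 0 0,
      addOrderOf (WeierstrassCurve.Affine.Point.some 0 0 h0) = 11 := by
  refine ⟨⟨isQuadraticField _, appearsAsTorsion_neg_seven, fun K _ _ _ hK h => ?_⟩,
    ⟨rankZero_neg_one, rankZero_neg_three, rankZero_five⟩, exists_infinite_order_point,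
    isElliptic_explicitCurve11, exists_addOrderOf_explicitCurve11⟩
  rw [discr_neg_seven, abs_neg, show |(7 : ℤ)| = 7 from rfl]
  refine ⟨?_, fun hd => (eq_of_abs_discr_le hK h hd.le).2⟩
  by_contra! hd
  rw [(eq_of_abs_discr_le hK h hd.le).1] at hd
  exact absurd hd (by decide)
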